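/- Let $\mathbb K$ be a field of characteristic zero, let $\mathcal K$ be a non-empty set of finite groups, and let $\ell$ be a monoid homomorphism from the positive integers under multiplication to $\mathbb K^\times$. For a finite group $G$ write $\ell(G)=\ell(|G|)$, and let $$\varphi(G)=\sum_{U\le G}\mu(U,G)\,\ell(U),$$ where $\mu$ is the Möbius function of the poset of subgroups of $G$ (equivalently, $\ell(G)=\sum_{U\le G}\varphi(U)$ for all finite groups $G$). Let $\Lambda=\Lambda_{\mathcal K}$ be the associative $\mathbb K$-algebra (not necessarily unital) with basis the elements $s_U^{F,G}$, where $F,G\in\mathcal K$ and $U\le F\times G$, and with multiplication $s_U^{F,G}\,s_V^{G,H}=\ell(U_\bullet\cap{}_\bullet V)\,s_{U*V}^{F,H}$, all other products of basis elements being zero. Here $U_\bullet=\{g\in G:(1,g)\in U\}$, ${}_\bullet V=\{g\in G:(g,1)\in V\}$ and $U*V=\{(f,h):\exists g\in G,\ (f,g)\in U,\ (g,h)\in V\}$. Put $\mathrm{id}_G=s_{\Delta(G)}^{G,G}$ with $\Delta(G)=\{(g,g):g\in G\}$. A $\Lambda$-module is an abelian group with an associative biadditive action of $\Lambda$ such that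 each element is fixed by an idempotent of $\Lambda$; write $M(G)=\mathrm{id}_G M$. A factor group of a finite group $G$ is a group isomorphic to $B/Y$ for some $Y\trianglelefteq B\le G$. A factor group $E$ of an element of $\mathcal K$ is called a minimal group of a simple $\Lambda$-module $S$ when there are a set $\mathcal K'\supseteq\mathcal K$ of finite groups, closed under factor groups up to isomorphism, and a simple $\Lambda_{\mathcal K'}$-module $S'$ such that $S\cong\Lambda S'$ and $E$ is isomorphic to some $E'\in\mathcal K'$ with $S'(E')\ne 0$ and such that every $F\in\mathcal K'$ which is a factor group of $E'$ and satisfies $S'(F)\neq0$ is isomorphic to $E'$. The trivial $\Lambda$-module $S_{1,1}$ is the simple $\Lambda$-module, well-defined up to isomorphism, whose minimal groups are trivial. When $\mathcal K$ is finite, $b_{1,1}$ denotes the unique block (primitive idempotent of the centre) of $\Lambda$ that acts as the identity on $S_{1,1}$. **Theorem.** Suppose that $\varphi(B)\neq0$ for every subgroup $B$ of every element of $\mathcal K$. Then a trivial $\Lambda$-module exists, and $S_{1,1}$ is projective and injective as a $\Lambda$-module. If moreover $\mathcal K$ is finite, then the block $b_{1,1}$ exists and is unique, and the principal block algebra $\Lambda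 b_{1,1}$ is simple. -/

import Mathlib

universe u v w w₁ w₂ w₃ w₄

/-! ### Modules over rings that need not have a unity

A module over a ring `A` is an abelian group with an associative, biadditive action of `A` such that
each element is fixed by an idempotent of `A`. When `A` is an algebra over a field, such a module is
a vector space in exactly one way compatible with the action, and all homomorphisms are linear. -/

/-- A module over a ring `A` (not necessarily unital), each element being fixed by an idempotent. -/
class LUModule (A : Type*) (M : Type*) [NonUnitalRing A] [AddCommGroup M] extends SMul A M where
  smul_add' : ∀ (a : A) (x y : M), a • (x + y) = a • x + a • y
  add_smul' : ∀ (a b : A) (x : M), (a + b) • x = a • x + b • x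
  mul_smul' : ∀ (a b : A) (x : M), (a * b) • x = a • (b • x)
  exists_idempotent : ∀ x : M, ∃ e : A, IsIdempotentElem e ∧ e • x = x

namespace LUModule

/-- The additive map `f` is a homomorphism of `A`-modules. -/
def IsHom (A : Type*) {M N : Type*} [NonUnitalRing A] [AddCommGroup M] [LUModule A M]
    [AddCommGroup N] [LUModule A N] (f : M →+ N) : Prop :=
  ∀ (a : A) (x : M), f (a • x) = a • f x

/-- A simple module: non-zero, with no submodules besides `0` and the whole module. -/
def IsSimple (A M : Type*) [NonUnitalRing A] [AddCommGroup M] [LUModule A M] : Prop :=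
  Nontrivial M ∧
    ∀ N : AddSubgroup M, (∀ (a : A), ∀ x ∈ N, a • x ∈ N) → N = ⊥ ∨ N = ⊤

/-- A projective module: homomorphisms from it lift through surjective homomorphisms. -/
def IsProjective (A : Type*) (P : Type w) [NonUnitalRing A] [AddCommGroup P] [LUModule A P] :
    Prop :=
  ∀ (M : Type w₁) (N : Type w₂) [AddCommGroup M] [LUModule A M] [AddCommGroup N] [LUModule A N]
    (g : M →+ N) (f : P →+ N), IsHom A g → Function.Surjective g → IsHom A f →
    ∃ h : P →+ M, IsHom A h ∧ g.comp h = f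

/-- An injective module: homomorphisms to it extend along injective homomorphisms. -/
def IsInjective (A : Type*) (I : Type w) [NonUnitalRing A] [AddCommGroup I] [LUModule A I] :
    Prop :=
  ∀ (M : Type w₁) (N : Type w₂) [AddCommGroup M] [LUModule A M] [AddCommGroup N] [LUModule A N]
    (g : M →+ N) (f : M →+ I), IsHom A g → Function.Injective g → IsHom A f →
    ∃ h : N →+ I, IsHom A h ∧ h.comp g = f

end LUModule

/-! ### Blocks -/

/-- A block of a ring: a primitive idempotent of the centre. -/
def IsBlock {A : Type*} [NonUnitalRing A] (b : A) : Prop :=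
  b ∈ Set.center A ∧ IsIdempotentElem b ∧ b ≠ 0 ∧
    ∀ c ∈ Set.center A, ∀ d ∈ Set.center A, IsIdempotentElem c → IsIdempotentElem d →
      c * d = 0 → d * c = 0 → c + d = b → c = 0 ∨ d = 0

/-- The algebra `A b = {a b : a ∈ A}`, as a subalgebra of the algebra `A` over `k`. -/
def mulRightSubalgebra (k : Type*) {A : Type*} [Field k] [NonUnitalRing A] [Module k A]
    [IsScalarTower k A A] (b : A) : NonUnitalSubalgebra k A where
  carrier := {x | ∃ a : A, a * b = x}
  add_mem' := by
    rintro _ _ ⟨x, rfl⟩ ⟨y, rfl⟩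
    exact ⟨x + y, add_mul x y b⟩
  zero_mem' := ⟨0, zero_mul b⟩
  mul_mem' := by
    rintro _ _ ⟨x, rfl⟩ ⟨y, rfl⟩
    exact ⟨x * b * y, mul_assoc (x * b) y b⟩
  smul_mem' := by
    rintro c _ ⟨x, rfl⟩
    exact ⟨c • x, smul_mul_assoc c x b⟩

namespace SubgroupCategory

/-! ### The subgroup category -/

section Star

variable {R S T Q : Type*} [Group R] [Group S] [Group T] [Group Q]

/-- The star product `U * V` of `U ≤ R × S` and `V ≤ S × T`. -/
def star (U : Subgroup (R × S)) (V : Subgroup (S × T)) : Subgroup (R × T) where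
  carrier := {p | ∃ s : S, (p.1, s) ∈ U ∧ (s, p.2) ∈ V}
  mul_mem' := by
    rintro ⟨r, t⟩ ⟨r', t'⟩ ⟨s, h₁, h₂⟩ ⟨s', h₁', h₂'⟩
    exact ⟨s * s', U.mul_mem h₁ h₁', V.mul_mem h₂ h₂'⟩
  one_mem' := ⟨1, U.one_mem, V.one_mem⟩
  inv_mem' := by
    rintro ⟨r, t⟩ ⟨s, h₁, h₂⟩
    exact ⟨s⁻¹, U.inv_mem h₁, V.inv_mem h₂⟩

/-- The subgroup `{y : (1, y) ∈ U}` of `S`, for `U ≤ R × S`. -/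
def rightKer (U : Subgroup (R × S)) : Subgroup S := U.comap (MonoidHom.inr R S)

/-- The subgroup `{x : (x, 1) ∈ U}` of `R`, for `U ≤ R × S`. -/
def leftKer (U : Subgroup (R × S)) : Subgroup R := U.comap (MonoidHom.inl R S)

/-- The diagonal subgroup `{(g, g) : g ∈ R}` of `R × R`. -/
def diag (R : Type*) [Group R] : Subgroup (R × R) :=
  ((MonoidHom.id R).prod (MonoidHom.id R)).range

theorem mem_star {U : Subgroup (R × S)} {V : Subgroup (S × T)} {r : R} {t : T} :
    (r, t) ∈ star U V ↔ ∃ s : S, (r, s) ∈ U ∧ (s, t) ∈ V := Iff.rfl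

theorem mem_rightKer {U : Subgroup (R × S)} {y : S} : y ∈ rightKer U ↔ ((1 : R), y) ∈ U := Iff.rfl

theorem mem_leftKer {U : Subgroup (R × S)} {x : R} : x ∈ leftKer U ↔ (x, (1 : S)) ∈ U := Iff.rfl

theorem star_assoc (U : Subgroup (R × S)) (V : Subgroup (S × T)) (W : Subgroup (T × Q)) :
    star (star U V) W = star U (star V W) := by
  ext ⟨r, q⟩
  simp only [mem_star]
  constructor
  · rintro ⟨t, ⟨s, h₁, h₂⟩, h₃⟩
    exact ⟨s, h₁, t, h₂, h₃⟩
  · rintro ⟨s, h₁, t, h₂, h₃⟩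
    exact ⟨t, ⟨s, h₁, h₂⟩, h₃⟩

/-- The identity of orders behind the cocycle condition. -/
theorem card_inf_mul_card_inf (U : Subgroup (R × S)) (V : Subgroup (S × T))
    (W : Subgroup (T × Q)) :
    Nat.card ↥(rightKer U ⊓ leftKer V) * Nat.card ↥(rightKer (star U V) ⊓ leftKer W) =
      Nat.card ↥(rightKer U ⊓ leftKer (star V W)) * Nat.card ↥(rightKer V ⊓ leftKer W) := by
  let A : Subgroup (S × T) :=
    (rightKer U).comap (MonoidHom.fst S T) ⊓ V ⊓ (leftKer W).comap (MonoidHom.snd S T)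
  have hA : ∀ s t, (s, t) ∈ A ↔ (((1 : R), s) ∈ U ∧ (s, t) ∈ V) ∧ (t, (1 : Q)) ∈ W :=
    fun s t => Iff.rfl
  let f : A →* S := (MonoidHom.fst S T).comp A.subtype
  let g : A →* T := (MonoidHom.snd S T).comp A.subtype
  have hf : Nat.card f.range = Nat.card ↥(rightKer U ⊓ leftKer (star V W)) := by
    congr 2
    ext s
    simp only [MonoidHom.mem_range, Subgroup.mem_inf, mem_rightKer, mem_leftKer, mem_star]
    constructor
    · rintro ⟨⟨⟨s', t⟩, h⟩, rfl⟩
      obtain ⟨⟨h₁, h₂⟩, h₃⟩ := (hA s' t).1 h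
      exact ⟨h₁, t, h₂, h₃⟩
    · rintro ⟨h₁, t, h₂, h₃⟩
      exact ⟨⟨(s, t), (hA s t).2 ⟨⟨h₁, h₂⟩, h₃⟩⟩, rfl⟩
  have hg : Nat.card g.range = Nat.card ↥(rightKer (star U V) ⊓ leftKer W) := by
    congr 2
    ext t
    simp only [MonoidHom.mem_range, Subgroup.mem_inf, mem_rightKer, mem_leftKer, mem_star]
    constructor
    · rintro ⟨⟨⟨s, t'⟩, h⟩, rfl⟩
      obtain ⟨⟨h₁, h₂⟩, h₃⟩ := (hA s t').1 h
      exact ⟨⟨s, h₁, h₂⟩, h₃⟩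
    · rintro ⟨⟨s, h₁, h₂⟩, h₃⟩
      exact ⟨⟨(s, t), (hA s t).2 ⟨⟨h₁, h₂⟩, h₃⟩⟩, rfl⟩
  have hf' : Nat.card f.ker = Nat.card ↥(rightKer V ⊓ leftKer W) := by
    refine Nat.card_congr ⟨fun x => ⟨x.1.1.2, ?_⟩, fun y => ⟨⟨(1, y.1), ?_⟩, ?_⟩, ?_, ?_⟩
    · obtain ⟨⟨⟨s, t⟩, h⟩, hx⟩ := x
      obtain rfl : s = 1 := hx
      obtain ⟨⟨h₁, h₂⟩, h₃⟩ := (hA 1 t).1 h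
      exact ⟨h₂, h₃⟩
    · exact (hA _ _).2 ⟨⟨U.one_mem, y.2.1⟩, y.2.2⟩
    · exact rfl
    · rintro ⟨⟨⟨s, t⟩, h⟩, hx⟩
      obtain rfl : s = 1 := hx
      rfl
    · intro y
      rfl
  have hg' : Nat.card g.ker = Nat.card ↥(rightKer U ⊓ leftKer V) := by
    refine Nat.card_congr ⟨fun x => ⟨x.1.1.1, ?_⟩, fun y => ⟨⟨(y.1, 1), ?_⟩, ?_⟩, ?_, ?_⟩
    · obtain ⟨⟨⟨s, t⟩, h⟩, hx⟩ := x
      obtain rfl : t = 1 := hx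
      obtain ⟨⟨h₁, h₂⟩, h₃⟩ := (hA s 1).1 h
      exact ⟨h₁, h₂⟩
    · exact (hA _ _).2 ⟨⟨y.2.1, y.2.2⟩, W.one_mem⟩
    · exact rfl
    · rintro ⟨⟨⟨s, t⟩, h⟩, hx⟩
      obtain rfl : t = 1 := hx
      rfl
    · intro y
      rfl
  rw [← hf, ← hg, ← hf', ← hg', ← Subgroup.index_ker f, ← Subgroup.index_ker g,
    Subgroup.card_mul_index, mul_comm, Subgroup.card_mul_index]

end Star

variable {𝕂 : Type u} [Field 𝕂]

/-- The value `ℓ(G) = ℓ(|G|)` on a finite group. -/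
noncomputable def ellGroup (ℓ : ℕ+ →* 𝕂ˣ) (G : Type*) [Group G] [Finite G] : 𝕂ˣ :=
  ℓ ((Nat.card G).toPNat Nat.card_pos)

/-- The cocycle `σ(U, V)`: the value of `ℓ` at the intersection of `{s : (1, s) ∈ U}` and
`{s : (s, 1) ∈ V}`. -/
noncomputable def cocycle (ℓ : ℕ+ →* 𝕂ˣ) {R S T : Type*} [Group R] [Group S] [Group T] [Finite S]
    (U : Subgroup (R × S)) (V : Subgroup (S × T)) : 𝕂 :=
  ellGroup ℓ ↥(rightKer U ⊓ leftKer V)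

theorem cocycle_mul_cocycle (ℓ : ℕ+ →* 𝕂ˣ) {R S T Q : Type*} [Group R] [Group S] [Group T]
    [Group Q] [Finite S] [Finite T] (U : Subgroup (R × S)) (V : Subgroup (S × T))
    (W : Subgroup (T × Q)) :
    cocycle ℓ U V * cocycle ℓ (star U V) W = cocycle ℓ U (star V W) * cocycle ℓ V W := by
  rw [cocycle, cocycle, cocycle, cocycle, ← Units.val_mul, ← Units.val_mul, ellGroup, ellGroup,
    ellGroup, ellGroup, ← map_mul, ← map_mul]
  congr 2
  exact PNat.eq (card_inf_mul_card_inf U V W)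

/-- The totient function of `ℓ`: `φ(G) = ∑ möb(U, G) ℓ(U)`, the sum being over the subgroups
`U` of the finite group `G`. -/
noncomputable def totient (ℓ : ℕ+ →* 𝕂ˣ) (G : Type*) [Group G] [Finite G] : 𝕂 := by
  classical
  letI : Fintype (Subgroup G) := Fintype.ofFinite (Subgroup G)
  letI : LocallyFiniteOrder (Subgroup G) := Fintype.toLocallyFiniteOrder
  exact ∑ U : Subgroup G, (IncidenceAlgebra.mu ℤ U ⊤ : 𝕂) * (ellGroup ℓ U : 𝕂)

/-- `S` is a factor group of `R`: it is isomorphic to `B / Y` for some `Y ⊴ B ≤ R`. -/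
def IsFactorGroup (S R : Type*) [Group S] [Group R] : Prop :=
  ∃ (B : Subgroup R) (Y : Subgroup B) (_ : Y.Normal), Nonempty (S ≃* B ⧸ Y)

/-- `𝒦` has an isomorphic copy of every subquotient of every element of `𝒦`. -/
def ClosedUnderFactorGroups (𝒦 : Set FiniteGrp.{v}) : Prop :=
  ∀ G ∈ 𝒦, ∀ (B : Subgroup G) (Y : Subgroup B) [Y.Normal], ∃ H ∈ 𝒦, Nonempty (H ≃* B ⧸ Y)

/-- A morphism `cod ← dom` of the full subcategory, on `𝒦`, of the subgroup category. -/
structure Mor (𝒦 : Set FiniteGrp.{v}) where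
  cod : 𝒦
  dom : 𝒦
  sub : Subgroup (cod.1 × dom.1)

/-! ### The algebra `Λ` -/

/-- The underlying vector space of the algebra `Λ` determined by `ℓ` and `𝒦`, with basis the
morphisms in the subgroup category between elements of `𝒦`. -/
def Lam (_ℓ : ℕ+ →* 𝕂ˣ) (𝒦 : Set FiniteGrp.{v}) : Type (max u (v + 1)) := Mor 𝒦 →₀ 𝕂

section Algebra

variable (ℓ : ℕ+ →* 𝕂ˣ) (𝒦 : Set FiniteGrp.{v})

noncomputable instance : AddCommGroup (Lam ℓ 𝒦) := inferInstanceAs (AddCommGroup (Mor 𝒦 →₀ 𝕂))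

noncomputable instance : Module 𝕂 (Lam ℓ 𝒦) := inferInstanceAs (Module 𝕂 (Mor 𝒦 →₀ 𝕂))

variable {𝒦}

/-- The basis element `s_U` of `Λ` indexed by a morphism `U`. -/
noncomputable def sq (U : Mor 𝒦) : Lam ℓ 𝒦 := (Finsupp.single U 1 : Mor 𝒦 →₀ 𝕂)

open Classical in
/-- The product `s_U s_V`, which is `σ(U, V) s_{U * V}` when the domain of `U` is the codomain of
`V`, and is zero otherwise. -/
noncomputable def sqMul (U V : Mor 𝒦) : Lam ℓ 𝒦 :=
  if h : V.cod = U.dom then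
    cocycle ℓ U.sub (h ▸ V.sub : Subgroup (U.dom.1 × V.dom.1)) •
      sq ℓ ⟨U.cod, V.dom, star U.sub (h ▸ V.sub : Subgroup (U.dom.1 × V.dom.1))⟩
  else 0

/-- The linear map on `Λ` with prescribed values on the basis. -/
noncomputable def linExt {N : Type*} [AddCommGroup N] [Module 𝕂 N] (f : Mor 𝒦 → N) :
    Lam ℓ 𝒦 →ₗ[𝕂] N :=
  (Finsupp.linearCombination 𝕂 f : (Mor 𝒦 →₀ 𝕂) →ₗ[𝕂] N)

theorem linExt_sq {N : Type*} [AddCommGroup N] [Module 𝕂 N] (f : Mor 𝒦 → N) (U : Mor 𝒦) :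
    linExt ℓ f (sq ℓ U) = f U :=
  (Finsupp.linearCombination_single 𝕂 (1 : 𝕂) U).trans (one_smul 𝕂 (f U))

variable (𝒦)

/-- The multiplication of `Λ`: the bilinear extension of the products of basis elements. -/
noncomputable def mulHom : Lam ℓ 𝒦 →ₗ[𝕂] Lam ℓ 𝒦 →ₗ[𝕂] Lam ℓ 𝒦 :=
  linExt ℓ fun U => linExt ℓ fun V => sqMul ℓ U V

noncomputable instance : Mul (Lam ℓ 𝒦) := ⟨fun a b => mulHom ℓ 𝒦 a b⟩

variable {𝒦}

theorem mul_eq (a b : Lam ℓ 𝒦) : a * b = mulHom ℓ 𝒦 a b := rfl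

theorem sq_mul_sq' (U V : Mor 𝒦) : sq ℓ U * sq ℓ V = sqMul ℓ U V := by
  rw [mul_eq, mulHom, linExt_sq, linExt_sq]

theorem sq_mul_sq {F G H : 𝒦} (U : Subgroup (F.1 × G.1)) (V : Subgroup (G.1 × H.1)) :
    sq ℓ ⟨F, G, U⟩ * sq ℓ ⟨G, H, V⟩ = cocycle ℓ U V • sq ℓ ⟨F, H, star U V⟩ := by
  rw [sq_mul_sq', sqMul, dif_pos rfl]

theorem sq_mul_sq_of_ne {U V : Mor 𝒦} (h : V.cod ≠ U.dom) : sq ℓ U * sq ℓ V = 0 := by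
  rw [sq_mul_sq', sqMul, dif_neg h]

theorem lam_ext {N : Type*} [AddCommMonoid N] [Module 𝕂 N] {f g : Lam ℓ 𝒦 →ₗ[𝕂] N}
    (h : ∀ U, f (sq ℓ U) = g (sq ℓ U)) : f = g :=
  Finsupp.lhom_ext' fun U => LinearMap.ext_ring (h U)

theorem smul_mul_lam (c : 𝕂) (a b : Lam ℓ 𝒦) : c • a * b = c • (a * b) := by
  simp only [mul_eq, map_smul, LinearMap.smul_apply]

theorem mul_smul_lam (c : 𝕂) (a b : Lam ℓ 𝒦) : a * c • b = c • (a * b) := by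
  simp only [mul_eq, map_smul]

theorem sq_assoc (U V W : Mor 𝒦) :
    sq ℓ U * sq ℓ V * sq ℓ W = sq ℓ U * (sq ℓ V * sq ℓ W) := by
  have zm : ∀ a : Lam ℓ 𝒦, 0 * a = 0 := fun a => by rw [mul_eq, map_zero, LinearMap.zero_apply]
  have mz : ∀ a : Lam ℓ 𝒦, a * 0 = 0 := fun a => by rw [mul_eq, map_zero]
  obtain ⟨F, G, U⟩ := U
  obtain ⟨G', H, V⟩ := V
  obtain ⟨H', I, W⟩ := W
  by_cases h₁ : G' = G
  · subst h₁
    by_cases h₂ : H' = H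
    · subst h₂
      rw [sq_mul_sq, sq_mul_sq, smul_mul_lam, mul_smul_lam, sq_mul_sq, sq_mul_sq, smul_smul,
        smul_smul, star_assoc, cocycle_mul_cocycle, mul_comm]
    · rw [sq_mul_sq, smul_mul_lam, sq_mul_sq_of_ne ℓ (V := ⟨H', I, W⟩) h₂,
        sq_mul_sq_of_ne ℓ (V := ⟨H', I, W⟩) h₂, smul_zero, mz]
  · rw [sq_mul_sq_of_ne ℓ (V := ⟨G', H, V⟩) h₁, zm]
    by_cases h₂ : H' = H
    · subst h₂
      rw [sq_mul_sq, mul_smul_lam, sq_mul_sq_of_ne ℓ (V := ⟨G', I, _⟩) h₁, smul_zero]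
    · rw [sq_mul_sq_of_ne ℓ (V := ⟨H', I, W⟩) h₂, mz]

theorem lam_mul_assoc (a b c : Lam ℓ 𝒦) : a * b * c = a * (b * c) := by
  have h : (mulHom ℓ 𝒦).compr₂ (mulHom ℓ 𝒦) =
      (LinearMap.lcomp 𝕂 (Lam ℓ 𝒦 →ₗ[𝕂] Lam ℓ 𝒦) (mulHom ℓ 𝒦)).comp
        ((LinearMap.llcomp 𝕂 (Lam ℓ 𝒦) (Lam ℓ 𝒦) (Lam ℓ 𝒦)).comp (mulHom ℓ 𝒦)) := by
    refine lam_ext ℓ fun U => lam_ext ℓ fun V => lam_ext ℓ fun W => ?_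
    exact sq_assoc ℓ U V W
  exact LinearMap.congr_fun (LinearMap.congr_fun (LinearMap.congr_fun h a) b) c

variable (𝒦)

noncomputable instance : NonUnitalRing (Lam ℓ 𝒦) :=
  { (inferInstance : AddCommGroup (Lam ℓ 𝒦)), (inferInstance : Mul (Lam ℓ 𝒦)) with
    left_distrib := fun a b c => by simp only [mul_eq, map_add]
    right_distrib := fun a b c => by simp only [mul_eq, map_add, LinearMap.add_apply]
    zero_mul := fun a => by rw [mul_eq, map_zero, LinearMap.zero_apply]
    mul_zero := fun a => by rw [mul_eq, map_zero]
    mul_assoc := lam_mul_assoc ℓ }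

instance : IsScalarTower 𝕂 (Lam ℓ 𝒦) (Lam ℓ 𝒦) := ⟨fun c a b => smul_mul_lam ℓ c a b⟩

instance : SMulCommClass 𝕂 (Lam ℓ 𝒦) (Lam ℓ 𝒦) := ⟨fun c a b => (mul_smul_lam ℓ c a b).symm⟩

variable {𝒦}

/-- The idempotent `id_G` of `Λ`, for `G ∈ 𝒦`. -/
noncomputable def idElem (G : 𝒦) : Lam ℓ 𝒦 := sq ℓ ⟨G, G, diag G.1⟩

/-- For `𝒦 ⊆ 𝒦'`, the inclusion of the algebra of `𝒦` in the algebra of `𝒦'`. -/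
noncomputable def incl {𝒦' : Set FiniteGrp.{v}} (h : 𝒦 ⊆ 𝒦') : Lam ℓ 𝒦 →ₗ[𝕂] Lam ℓ 𝒦' :=
  linExt ℓ fun U =>
    sq ℓ ⟨⟨U.cod.1, h U.cod.2⟩, ⟨U.dom.1, h U.dom.2⟩, U.sub⟩

/-- The evaluation `M(G) = id_G M` of a `Λ`-module `M` at `G ∈ 𝒦` is non-zero. -/
def EvalNonzero (M : Type*) [AddCommGroup M] [LUModule (Lam ℓ 𝒦) M] (G : 𝒦) : Prop :=
  ∃ x : M, idElem ℓ G • x ≠ 0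

variable (𝒦)

/-- The finite group `E` is a minimal group of the simple `Λ`-module `S`. This means that, for some
set `𝒦'` of finite groups that contains `𝒦` and is closed under factor groups up to isomorphism, and
with `Λ'` the algebra of `𝒦'`, there is a simple `Λ'`-module `S'` with `S` isomorphic to `Λ S'`, and
there is an isomorphic copy `E'` of `E` in `𝒦'` that is minimal, up to isomorphism and with respect
to the relation of being a factor group, subject to `S'(E')` being non-zero. Also, `E` has to be a
factor group of an element of `𝒦`. (Every simple `Λ'`-module is isomorphic to a quotient of `Λ'`, so
there is no loss in the universe of `S'`.) -/
def HasMinimalGroup (S : Type w) [AddCommGroup S] [LUModule (Lam ℓ 𝒦) S]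
    (E : Type*) [Group E] : Prop :=
  (∃ G ∈ 𝒦, IsFactorGroup E G) ∧
  ∃ (𝒦' : Set FiniteGrp.{v}) (h : 𝒦 ⊆ 𝒦') (S' : Type (max u (v + 1))) (_ : AddCommGroup S')
    (_ : LUModule (Lam ℓ 𝒦') S') (E' : 𝒦'),
    ClosedUnderFactorGroups 𝒦' ∧ LUModule.IsSimple (Lam ℓ 𝒦') S' ∧
    Nonempty (E' ≃* E) ∧ EvalNonzero ℓ S' E' ∧
    (∀ F : 𝒦', EvalNonzero ℓ S' F → IsFactorGroup F E' → Nonempty (F ≃* E')) ∧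
    ∃ f : S →+ S', Function.Injective f ∧ (∀ (a : Lam ℓ 𝒦) (x : S), f (a • x) = incl ℓ h a • f x) ∧
      f.range = AddSubgroup.closure {z | ∃ (a : Lam ℓ 𝒦) (y : S'), z = incl ℓ h a • y}

/-- `S` is a trivial `Λ`-module: it is simple and its minimal groups are trivial. -/
def IsTrivialModule (S : Type w) [AddCommGroup S] [LUModule (Lam ℓ 𝒦) S] : Prop :=
  LUModule.IsSimple (Lam ℓ 𝒦) S ∧ HasMinimalGroup ℓ 𝒦 S Unit

/-- `b` is a block of `Λ` that acts as the identity on `S`. -/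
def IsBlockFixing (S : Type w) [AddCommGroup S] [LUModule (Lam ℓ 𝒦) S] (b : Lam ℓ 𝒦) : Prop :=
  IsBlock b ∧ ∀ x : S, b • x = x

end Algebra

end SubgroupCategory

/-! Fix `F` in `𝒦` and let `e` be the basis element of the trivial subgroup of `F × F`. A star
product with a direct product is again a direct product, so `Λe` is spanned by the `s_{C × 1}` and
`eΛ` by the `s_{1 × B}`. Hence `e` is an idempotent with `eΛe = 𝕂e`. For subgroups `B`, `C` of one
group `G`, the product of `s_{1 × B}` and `s_{C × 1}` is `ℓ(B ∩ C) e`. Möbius inversion factors this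
Gram matrix as `Zᵀ diag(φ) Z`, with `Z` the zeta matrix of the subgroup lattice, so it is invertible
because `φ` does not vanish. If `Q` is its inverse, then `∑ Q(B, C) s_{B × C}` lies in `ΛeΛ` and
acts as `id_G` on `Λe` and on `eΛ`. This yields `HasDualBases`.

What remains is formal for a rank one idempotent with dual bases. The pairing of `eΛ` with `Λe` is
non-degenerate. A simple module `S` with a non-zero vector fixed by `e` is isomorphic to `Λe`, hence
projective. Its vectors are separated by `eΛ`, which reduces the extension of maps into `S` to the
extension of linear maps on the spaces of vectors fixed by `e`; hence `S` is injective. If `Λ` has a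
unity, the element of `ΛeΛ` that stands in for it is a central idempotent; it is the block, and it
cuts out a simple ring.

Trivial modules fit this pattern because the identity of a trivial group is `s_{1 × 1}`, which
factors through `F`: a simple module that is non-zero at the trivial group contains a non-zero
vector fixed by `e`. One exists, namely the quotient of `Λ` by the elements whose image in `Λe` is
annihilated by `eΛ`. -/

namespace LUModule

/-! ### Elementary properties of modules over rings without unity -/

section Basic

variable {A M : Type*} [NonUnitalRing A] [AddCommGroup M] [LUModule A M]

/-- The action of a ring on a module, as a biadditive map. -/
def actionHom (A M : Type*) [NonUnitalRing A] [AddCommGroup M] [LUModule A M] : A →+ M →+ M :=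
  AddMonoidHom.mk' (fun a => AddMonoidHom.mk' (fun x => a • x) (smul_add' a))
    fun a b => AddMonoidHom.ext fun x => add_smul' a b x

theorem zero_smul' (x : M) : (0 : A) • x = 0 :=
  DFunLike.congr_fun (map_zero (actionHom A M)) x

theorem smul_zero' (a : A) : a • (0 : M) = 0 := map_zero (actionHom A M a)

theorem neg_smul' (a : A) (x : M) : (-a) • x = -(a • x) :=
  DFunLike.congr_fun (map_neg (actionHom A M) a) x

theorem smul_neg' (a : A) (x : M) : a • (-x) = -(a • x) := map_neg (actionHom A M a) x

theorem sub_smul' (a b : A) (x : M) : (a - b) • x = a • x - b • x :=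
  DFunLike.congr_fun (map_sub (actionHom A M) a b) x

theorem smul_sub' (a : A) (x y : M) : a • (x - y) = a • x - a • y := map_sub (actionHom A M a) x y

/-- In a simple module, every non-zero element generates. -/
theorem IsSimple.exists_smul_eq (h : IsSimple A M) {x : M} (hx : x ≠ 0) (y : M) :
    ∃ a : A, a • x = y := by
  let N : AddSubgroup M := ((actionHom A M).flip x).range
  have hN : N = ⊥ ∨ N = ⊤ := by
    refine h.2 N ?_
    rintro a _ ⟨b, rfl⟩
    exact ⟨a * b, mul_smul' a b x⟩
  -- Without a unity, `x` lies in `A x` only because some idempotent fixes it.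
  have hxN : x ∈ N := by
    obtain ⟨e, -, he⟩ := exists_idempotent (A := A) x
    exact ⟨e, he⟩
  rcases hN with hN | hN
  · rw [hN, AddSubgroup.mem_bot] at hxN
    exact absurd hxN hx
  · have : y ∈ N := hN ▸ AddSubgroup.mem_top y
    exact this

end Basic

/-- The elements of a module that are fixed by `e`. -/
def fixedBy {A : Type*} (M : Type*) [NonUnitalRing A] [AddCommGroup M] [LUModule A M] (e : A) :
    AddSubgroup M where
  carrier := {x | e • x = x}
  add_mem' {x y} hx hy := by
    rw [Set.mem_ofPred_eq] at hx hy ⊢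
    rw [smul_add', hx, hy]
  zero_mem' := smul_zero' e
  neg_mem' {x} hx := by
    rw [Set.mem_ofPred_eq] at hx ⊢
    rw [smul_neg', hx]

theorem smul_mem_fixedBy {A M : Type*} [NonUnitalRing A] [AddCommGroup M] [LUModule A M]
    {e : A} (he : e * e = e) (a : A) (x : M) :
    (e * a) • x ∈ fixedBy M e := by
  change e • (e * a) • x = (e * a) • x
  rw [← mul_smul', ← mul_assoc, he]

/-- The elements fixed by an idempotent `e` form a vector space, where a scalar `c` acts as
`c • e`. -/
@[reducible]
def fixedByModule (k : Type*) {A : Type*} (M : Type*) [Field k] [NonUnitalRing A] [Module k A]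
    [IsScalarTower k A A] [SMulCommClass k A A] [AddCommGroup M] [LUModule A M] {e : A}
    (he : e * e = e) : Module k (fixedBy M e) where
  smul c x := ⟨(c • e) • x.1, by
    change e • (c • e) • x.1 = (c • e) • x.1
    rw [← mul_smul', mul_smul_comm, he]⟩
  one_smul x := Subtype.ext <| by
    change ((1 : k) • e) • x.1 = x.1
    rw [one_smul]
    exact x.2
  mul_smul c d x := Subtype.ext <| by
    change ((c * d) • e) • x.1 = (c • e) • (d • e) • x.1
    rw [← mul_smul', mul_smul_comm, smul_mul_assoc, he, smul_smul, mul_comm]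
  smul_zero c := Subtype.ext (smul_zero' (c • e))
  smul_add c x y := Subtype.ext (smul_add' (c • e) x.1 y.1)
  add_smul c d x := Subtype.ext <| by
    change ((c + d) • e) • x.1 = (c • e) • x.1 + (d • e) • x.1
    rw [add_smul, add_smul']
  zero_smul x := Subtype.ext <| by
    change ((0 : k) • e) • x.1 = 0
    rw [zero_smul, zero_smul']

/-- Along an injective homomorphism, there is a retraction on the elements fixed by an
idempotent. -/
theorem exists_retraction_fixedBy (k : Type*) {A M N : Type*} [Field k] [NonUnitalRing A]
    [Module k A] [IsScalarTower k A A] [SMulCommClass k A A] [AddCommGroup M] [LUModule A M]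
    [AddCommGroup N] [LUModule A N] {e : A} (he : e * e = e) (g : M →+ N) (hg : IsHom A g)
    (hinj : Function.Injective g) :
    ∃ r : fixedBy N e →+ fixedBy M e,
      (∀ (c : k) (x y : fixedBy N e), y.1 = (c • e) • x.1 → (r y).1 = (c • e) • (r x).1) ∧
      ∀ (x : fixedBy M e) (y : fixedBy N e), y.1 = g x.1 → r y = x := by
  -- These vector space structures are local to the proof, so the statement expresses linearity of
  -- `r` through the action of `c • e`.
  let := fixedByModule k M he
  let := fixedByModule k N he
  let g' : fixedBy M e →ₗ[k] fixedBy N e :=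
    { toFun := fun x => ⟨g x.1, by
        change e • g x.1 = g x.1
        rw [← hg, show e • x.1 = x.1 from x.2]⟩
      map_add' := fun x y => Subtype.ext (map_add g x.1 y.1)
      map_smul' := fun c x => Subtype.ext (hg (c • e) x.1) }
  have hker : LinearMap.ker g' = ⊥ :=
    LinearMap.ker_eq_bot.2 fun x y h => Subtype.ext (hinj (congrArg Subtype.val h))
  obtain ⟨r, hr⟩ := g'.exists_leftInverse_of_injective hker
  refine ⟨r.toAddMonoidHom, fun c x y h => ?_, fun x y h => ?_⟩
  · have hy : y = c • x := Subtype.ext h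
    rw [hy]
    exact congrArg Subtype.val (r.map_smul c x)
  · have hy : y = g' x := Subtype.ext h
    rw [hy]
    exact LinearMap.congr_fun hr x

end LUModule

/-! ### Idempotents of rank one -/

/-- A non-zero idempotent `e` of an algebra with local units such that `e A e` consists of the
scalar multiples of `e`. -/
structure IsRankOneIdempotent (k : Type*) {A : Type*} [Field k] [NonUnitalRing A] [Module k A]
    (e : A) : Prop where
  mul_self : e * e = e
  ne_zero : e ≠ 0
  corner : ∀ a : A, ∃ c : k, e * a * e = c • e
  exists_unit : ∀ a : A, ∃ f : A, IsIdempotentElem f ∧ f * a = a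

/-- The ideal generated by `e`, as the set of sums of elements `a e b`. -/
def sandwichIdeal {A : Type*} [NonUnitalRing A] (e : A) : AddSubgroup A :=
  AddSubgroup.closure (Set.range fun p : A × A => p.1 * e * p.2)

/-- Every element of the algebra acts on `A e` from the left, and on `e A` from the right, as an
element of the ideal `A e A`. -/
def HasDualBases {A : Type*} [NonUnitalRing A] (e : A) : Prop :=
  ∀ x : A, ∃ j ∈ sandwichIdeal e, (∀ a, x * (a * e) = j * (a * e)) ∧ ∀ b, e * b * x = e * b * j

/-! ### The two-sided ideal generated by an element -/

section Ideal

variable {A : Type*} [NonUnitalRing A]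

theorem mul_mem_sandwichIdeal {e : A} (x : A) {y : A} (hy : y ∈ sandwichIdeal e) :
    x * y ∈ sandwichIdeal e := by
  induction hy using AddSubgroup.closure_induction with
  | mem y hy =>
    obtain ⟨⟨u, v⟩, rfl⟩ := hy
    exact AddSubgroup.subset_closure ⟨(x * u, v), by simp only [mul_assoc]⟩
  | zero => rw [mul_zero]; exact zero_mem _
  | add y z _ _ hy hz => rw [mul_add]; exact add_mem hy hz
  | neg y _ hy => rw [mul_neg]; exact neg_mem hy

theorem sandwichIdeal_mul_mem {e : A} {y : A} (hy : y ∈ sandwichIdeal e) (x : A) :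
    y * x ∈ sandwichIdeal e := by
  induction hy using AddSubgroup.closure_induction with
  | mem y hy =>
    obtain ⟨⟨u, v⟩, rfl⟩ := hy
    exact AddSubgroup.subset_closure ⟨(u, v * x), by simp only [mul_assoc]⟩
  | zero => rw [zero_mul]; exact zero_mem _
  | add y z _ _ hy hz => rw [add_mul]; exact add_mem hy hz
  | neg y _ hy => rw [neg_mul]; exact neg_mem hy

/-- If `x` annihilates `A e` from the left, then it annihilates the ideal generated by `e`. -/
theorem mul_eq_zero_of_mem_sandwichIdeal {e x y : A} (h : ∀ a, x * (a * e) = 0)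
    (hy : y ∈ sandwichIdeal e) : x * y = 0 := by
  induction hy using AddSubgroup.closure_induction with
  | mem y hy =>
    obtain ⟨⟨u, v⟩, rfl⟩ := hy
    change x * (u * e * v) = 0
    rw [← mul_assoc, h, zero_mul]
  | zero => rw [mul_zero]
  | add y z _ _ hy hz => rw [mul_add, hy, hz, add_zero]
  | neg y _ hy => rw [mul_neg, hy, neg_zero]

/-- An algebra with unity has a central idempotent that acts as a unity on the ideal generated by
`e`, and belongs to that ideal. -/
theorem HasDualBases.exists_central {e : A} (hd : HasDualBases e) {i : A}
    (hi : ∀ a, i * a = a ∧ a * i = a) :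
    ∃ j ∈ sandwichIdeal e, (∀ x, j * x = x * j) ∧ (∀ y ∈ sandwichIdeal e, j * y = y) := by
  obtain ⟨j, hj, hjl, hjr⟩ := hd i
  have hone : ∀ y ∈ sandwichIdeal e, j * y = y := by
    intro y hy
    rw [← sub_eq_zero]
    have := mul_eq_zero_of_mem_sandwichIdeal (x := j - i)
      (fun a => by rw [sub_mul, hjl, sub_self]) hy
    rwa [sub_mul, (hi y).1] at this
  refine ⟨j, hj, fun x => ?_, hone⟩
  -- The commutator lies in the ideal, where `j` acts as a left unity. It is also killed on the left
  -- by every `e * b`, hence by `j`, a sum of terms `u * e * v`. So it is zero.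
  have hmem : j * x - x * j ∈ sandwichIdeal e :=
    sub_mem (sandwichIdeal_mul_mem hj x) (mul_mem_sandwichIdeal x hj)
  rw [← sub_eq_zero, ← hone _ hmem]
  have hw : ∀ b, e * b * (j * x - x * j) = 0 := by
    intro b
    rw [mul_sub, ← mul_assoc, ← hjr, (hi _).2, ← mul_assoc, mul_assoc e b x, ← hjr, (hi _).2,
      sub_self]
  generalize j * x - x * j = z at hw
  clear hmem hjl hjr hone
  induction hj using AddSubgroup.closure_induction with
  | mem y hy =>
    obtain ⟨⟨u, v⟩, rfl⟩ := hy
    change u * e * v * z = 0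
    rw [mul_assoc u, mul_assoc u, hw, mul_zero]
  | zero => rw [zero_mul]
  | add y z _ _ hy hz => rw [add_mul, hy, hz, add_zero]
  | neg y _ hy => rw [neg_mul, hy, neg_zero]

end Ideal

/-! ### Consequences of rank one and dual bases -/

namespace IsRankOneIdempotent

open LUModule

variable {k A : Type*} [Field k] [NonUnitalRing A] [Module k A] {e : A}

/-- Non-degeneracy of the pairing of `e A` with `A e`: a local unit of `a` acts on `A e` as an
element of `A e A`, and each term `p * e * q` of the latter kills `a * e`. -/
theorem eq_zero_of_forall (he : IsRankOneIdempotent k e) (hd : HasDualBases e) {a : A}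
    (h : ∀ b, e * b * (a * e) = 0) : a * e = 0 := by
  obtain ⟨f, -, hf⟩ := he.exists_unit a
  obtain ⟨j, hj, hl, -⟩ := hd f
  have key : ∀ y ∈ sandwichIdeal e, y * (a * e) = 0 := by
    intro y hy
    induction hy using AddSubgroup.closure_induction with
    | mem y hy =>
      obtain ⟨⟨p, q⟩, rfl⟩ := hy
      change p * e * q * (a * e) = 0
      rw [mul_assoc p, mul_assoc p, h, mul_zero]
    | zero => rw [zero_mul]
    | add y z _ _ hy hz => rw [add_mul, hy, hz, add_zero]
    | neg y _ hy => rw [neg_mul, hy, neg_zero]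
  calc a * e = f * (a * e) := by rw [← mul_assoc, hf]
    _ = 0 := by rw [hl, key j hj]

theorem mem_sandwichIdeal (he : IsRankOneIdempotent k e) : e ∈ sandwichIdeal e :=
  AddSubgroup.subset_closure ⟨(e, e), by simp only [he.mul_self]⟩

theorem central_ne_zero {j : A} (he : IsRankOneIdempotent k e)
    (hone : ∀ y ∈ sandwichIdeal e, j * y = y) : j ≠ 0 := fun h =>
  he.ne_zero (by rw [← hone e he.mem_sandwichIdeal, h, zero_mul])

variable [SMulCommClass k A A]

/-- A central `c` satisfies `c * e = e * c * e = α • e`. If `j = c + d` is an orthogonal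
decomposition, then `α • (d * e) = 0`, so one of `c`, `d` kills `e`. By centrality it kills `A e A`,
which contains `j`, and so it is zero. -/
theorem isBlock {j : A} (he : IsRankOneIdempotent k e) (hj : j ∈ sandwichIdeal e)
    (hc : ∀ x, j * x = x * j) (hone : ∀ y ∈ sandwichIdeal e, j * y = y) : IsBlock j := by
  refine ⟨Semigroup.mem_center_iff.2 fun x => (hc x).symm, hone j hj, he.central_ne_zero hone, ?_⟩
  intro c hcc d hdc hci hdi hcd hdc' hsum
  have hcc' := Semigroup.mem_center_iff.1 hcc
  have hdc'' := Semigroup.mem_center_iff.1 hdc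
  have kill : ∀ z : A, (∀ x, x * z = z * x) → z * j = z → z * e = 0 → z = 0 := by
    intro z hz hzj hze
    rw [← hzj]
    refine mul_eq_zero_of_mem_sandwichIdeal (fun a => ?_) hj
    rw [← mul_assoc, ← hz, mul_assoc, hze, mul_zero]
  have hcj : c * j = c := by rw [← hsum, mul_add, hci, hcd, add_zero]
  have hdj : d * j = d := by rw [← hsum, mul_add, hdi, hdc', zero_add]
  obtain ⟨α, hα⟩ := he.corner c
  have hce : c * e = α • e := by rw [← hα, hcc', mul_assoc, he.mul_self]
  by_cases h0 : α = 0
  · left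
    exact kill c hcc' hcj (by rw [hce, h0, zero_smul])
  · right
    refine kill d hdc'' hdj ?_
    have h1 : α • (d * e) = 0 := by
      rw [← mul_smul_comm, ← hce, ← mul_assoc, hdc', zero_mul]
    exact (smul_eq_zero.1 h1).resolve_left h0

variable [IsScalarTower k A A]

/-- Non-degeneracy provides a non-zero value of the pairing; this is a scalar multiple of `e`, and
the scalar can be inverted. -/
theorem exists_mul_eq (he : IsRankOneIdempotent k e) (hd : HasDualBases e) {a : A}
    (h : a * e ≠ 0) : ∃ b, e * b * (a * e) = e := by
  by_contra! hb
  refine h (he.eq_zero_of_forall hd fun b => ?_)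
  obtain ⟨c, hc⟩ := he.corner (b * a)
  have hc' : e * b * (a * e) = c • e := by rw [← hc]; simp only [mul_assoc]
  by_cases h0 : c = 0
  · rw [hc', h0, zero_smul]
  · refine absurd ?_ (hb (c⁻¹ • b))
    rw [mul_smul_comm, smul_mul_assoc, hc', smul_smul, inv_mul_cancel₀ h0, one_smul]

/-! ### Projectivity and injectivity of a simple module with a vector fixed by the idempotent -/

section Modules

variable {S : Type w} [AddCommGroup S] [LUModule A S]

/-- This is injectivity of the map from `A e` to `S` sending `a * e` to `a • x`; when `S` is simple,
the map identifies the two modules. -/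
theorem mul_eq_zero_of_smul_eq_zero (he : IsRankOneIdempotent k e) (hd : HasDualBases e) {x : S}
    (hx : x ≠ 0) (hex : e • x = x) {a : A} (h : a • x = 0) : a * e = 0 := by
  by_contra h0
  obtain ⟨b, hb⟩ := he.exists_mul_eq hd h0
  apply hx
  rw [← hex, ← hb, mul_smul', mul_smul' a e, hex, h, smul_zero']

theorem isProjective (he : IsRankOneIdempotent k e) (hd : HasDualBases e) (hS : IsSimple A S)
    {x : S} (hx : x ≠ 0) (hex : e • x = x) : IsProjective.{w, w₁, w₂} A S := by
  intro M N _ _ _ _ g f hg hsurj hf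
  choose α hα using fun y : S => hS.exists_smul_eq hx y
  obtain ⟨m, hm⟩ := hsurj (f x)
  -- Elements that agree on `x` have the same product with `e`, so `a • e • m` depends only on `a •
  -- x`.
  have key : ∀ (a : A) (y : S), a • x = y → α y • e • m = a • e • m := by
    intro a y hy
    have h := he.mul_eq_zero_of_smul_eq_zero hd hx hex (a := α y - a)
      (by rw [sub_smul', hα, hy, sub_self])
    rw [← sub_eq_zero, ← sub_smul', ← mul_smul', h, zero_smul']
  refine ⟨AddMonoidHom.mk' (fun y => α y • e • m) fun y z => ?_, fun a y => ?_, ?_⟩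
  · rw [← add_smul']
    exact key _ _ (by rw [add_smul', hα, hα])
  · change α (a • y) • e • m = a • α y • e • m
    exact (key (a * α y) _ (by rw [mul_smul', hα])).trans (mul_smul' _ _ _)
  · ext y
    change g (α y • e • m) = f y
    rw [hg, hg, hm, ← hf e, hex, ← hf, hα]

/-- The elements of `e A` separate the points of `S`, because `S` is a copy of `A e` and the pairing
is non-degenerate. -/
theorem eq_zero_of_forall_smul (he : IsRankOneIdempotent k e) (hd : HasDualBases e)
    (hS : IsSimple A S) {x : S} (hx : x ≠ 0) (hex : e • x = x) {y : S}
    (h : ∀ b : A, (e * b) • y = 0) : y = 0 := by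
  obtain ⟨a, rfl⟩ := hS.exists_smul_eq hx y
  have h0 : a * e = 0 := by
    by_contra h0
    obtain ⟨b, hb⟩ := he.exists_mul_eq hd h0
    apply hx
    rw [← hex, ← hb, mul_smul', mul_smul' a e, hex, h]
  rw [← hex, ← mul_smul', h0, zero_smul']

/-- A retraction `r` of the vectors of `N` fixed by `e` onto those of `M` is linear only over `k`.
The extension `h` is determined by requiring `(e * b) • h n = f (r ((e * b) • n))` for all `b`:
uniqueness is the separation property, and existence comes from the dual bases. Additivity,
equivariance and agreement with `f` then follow from uniqueness. -/
theorem isInjective (he : IsRankOneIdempotent k e) (hd : HasDualBases e) (hS : IsSimple A S)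
    {x : S} (hx : x ≠ 0) (hex : e • x = x) : IsInjective.{w, w₃, w₄} A S := by
  intro M N _ _ _ _ g f hg hinj hf
  obtain ⟨r, hr, hrg⟩ := exists_retraction_fixedBy k he.mul_self g hg hinj
  let p (b : A) (n : N) : fixedBy N e := ⟨(e * b) • n, smul_mem_fixedBy he.mul_self b n⟩
  have p_add : ∀ b n n', p b (n + n') = p b n + p b n' :=
    fun b n n' => Subtype.ext (smul_add' _ _ _)
  have uniq : ∀ y z : S, (∀ b : A, (e * b) • y = (e * b) • z) → y = z := by
    intro y z h
    refine sub_eq_zero.1 (he.eq_zero_of_forall_smul hd hS hx hex fun b => ?_)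
    rw [smul_sub', h, sub_self]
  have ex' : ∀ (n : N), ∀ j ∈ sandwichIdeal e, ∃ s : S, ∀ b : A,
      (e * b) • s = f (r (p b (j • n))).1 := by
    intro n j hj
    induction hj using AddSubgroup.closure_induction with
    | mem j hj =>
      obtain ⟨⟨u, v⟩, rfl⟩ := hj
      -- This value is forced: `h` must commute with `u` and equal `f ∘ r` on vectors fixed by `e`.
      refine ⟨u • f (r (p v n)).1, fun b => ?_⟩
      obtain ⟨c, hc⟩ := he.corner (b * u)
      have h1 : (p b ((u * e * v) • n)).1 = (c • e) • (p v n).1 := by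
        change (e * b) • (u * e * v) • n = (c • e) • (e * v) • n
        rw [← mul_smul', ← mul_smul', ← hc]
        congr 1
        calc e * b * (u * e * v) = e * (b * u) * (e * v) := by simp only [mul_assoc]
          _ = e * (b * u) * (e * e * v) := by rw [he.mul_self]
          _ = e * (b * u) * e * (e * v) := by simp only [mul_assoc]
      rw [hr c _ _ h1, hf, ← hc, ← mul_smul']
      have h2 : e • f (r (p v n)).1 = f (r (p v n)).1 := by
        rw [← hf, show e • (r (p v n)).1 = (r (p v n)).1 from (r (p v n)).2]
      rw [mul_smul' (e * (b * u)), h2, mul_assoc]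
    | zero =>
      refine ⟨0, fun b => ?_⟩
      have h0 : p b ((0 : A) • n) = 0 := Subtype.ext (by
        change (e * b) • (0 : A) • n = 0
        rw [zero_smul', smul_zero'])
      rw [h0, map_zero, smul_zero']
      exact (map_zero f).symm
    | add j j' _ _ hj hj' =>
      obtain ⟨s, hs⟩ := hj
      obtain ⟨s', hs'⟩ := hj'
      refine ⟨s + s', fun b => ?_⟩
      rw [smul_add', hs, hs', add_smul', p_add, map_add]
      exact (map_add f _ _).symm
    | neg j _ hj =>
      obtain ⟨s, hs⟩ := hj
      refine ⟨-s, fun b => ?_⟩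
      have h0 : p b ((-j) • n) = -p b (j • n) := Subtype.ext (by
        change (e * b) • (-j) • n = -((e * b) • j • n)
        rw [neg_smul', smul_neg'])
      rw [smul_neg', hs, h0, map_neg]
      exact (map_neg f _).symm
  have ex : ∀ n : N, ∃ s : S, ∀ b : A, (e * b) • s = f (r (p b n)).1 := by
    intro n
    obtain ⟨i, -, hi⟩ := exists_idempotent (A := A) n
    -- Since `e * b * j = e * b * i` and `i` fixes `n`, the conditions for `j • n` are those for
    -- `n`.
    obtain ⟨j, hj, -, hjr⟩ := hd i
    obtain ⟨s, hs⟩ := ex' n j hj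
    refine ⟨s, fun b => ?_⟩
    have h0 : p b (j • n) = p b n := Subtype.ext (by
      change (e * b) • j • n = (e * b) • n
      rw [← mul_smul', ← hjr, mul_smul', hi])
    rw [hs, h0]
  choose h hh using ex
  refine ⟨AddMonoidHom.mk' h fun n n' => ?_, fun a n => ?_, ?_⟩
  · refine uniq _ _ fun b => ?_
    rw [smul_add', hh, hh, hh, p_add, map_add]
    exact map_add f _ _
  · refine uniq _ _ fun b => ?_
    change (e * b) • h (a • n) = (e * b) • a • h n
    have h0 : p b (a • n) = p (b * a) n := Subtype.ext (by
      change (e * b) • a • n = (e * (b * a)) • n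
      rw [← mul_smul', mul_assoc])
    rw [hh, ← mul_smul', mul_assoc, hh, h0]
  · ext m
    refine uniq _ _ fun b => ?_
    change (e * b) • h (g m) = (e * b) • f m
    rw [hh, hrg ⟨(e * b) • m, smul_mem_fixedBy he.mul_self b m⟩ _ (hg _ _).symm, ← hf]

end Modules

/-! #### The block of a rank one idempotent -/

section Block

variable {j : A}

/-- The product `b * c` is a central idempotent, non-zero because it fixes `S`. Primitivity applied
to `b = b * c + (b - b * c)` gives `b = b * c`, and the situation is symmetric. -/
theorem eq_of_isBlock {S : Type*} [AddCommGroup S] [LUModule A S] [Nontrivial S] {b c : A}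
    (hb : IsBlock b) (hc : IsBlock c) (hbS : ∀ x : S, b • x = x) (hcS : ∀ x : S, c • x = x) :
    b = c := by
  have main : ∀ b c : A, IsBlock b → IsBlock c → (∀ x : S, b • x = x) → (∀ x : S, c • x = x) →
      b = b * c := by
    intro b c hb hc hbS hcS
    obtain ⟨y, hy⟩ := exists_ne (0 : S)
    have hbc : b * c ≠ 0 := by
      intro h
      apply hy
      rw [← hbS y, ← hcS y, ← mul_smul', h, zero_smul']
    have hcomm := Semigroup.mem_center_iff.1 hc.1
    have hcommb := Semigroup.mem_center_iff.1 hb.1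
    have h1 : b * c * b = b * c := by rw [mul_assoc, hcommb, ← mul_assoc, hb.2.1]
    have h2 : b * c * (b * c) = b * c := by rw [← mul_assoc, h1, mul_assoc, hc.2.1]
    have h3 : b * (b * c) = b * c := by rw [← mul_assoc, hb.2.1]
    have hbcc : b * c ∈ Set.center A := Set.mul_mem_center hb.1 hc.1
    have hsub : b - b * c ∈ Set.center A := by
      rw [Semigroup.mem_center_iff]
      intro x
      rw [mul_sub, sub_mul, hcommb, Semigroup.mem_center_iff.1 hbcc]
    rcases hb.2.2.2 (b * c) hbcc (b - b * c) hsub h2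
      (by rw [IsIdempotentElem, mul_sub, sub_mul, sub_mul, hb.2.1, h3, h1, h2, sub_self, sub_zero])
      (by rw [mul_sub, h1, h2, sub_self]) (by rw [sub_mul, h3, h2, sub_self])
      (by rw [add_sub_cancel]) with h | h
    · exact absurd h hbc
    · exact sub_eq_zero.1 h
  rw [main b c hb hc hbS hcS, ← Semigroup.mem_center_iff.1 hb.1 c]
  exact (main c b hc hb hcS hbS).symm

/-- A non-zero `y` in an ideal of `A j` has `y * a * e ≠ 0` for some `a`, since otherwise it would
kill `j`. Then some `e * b * y * a * e` equals `e`, so the ideal contains `e` and with it all of `A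
e A`, which is `A j`. -/
theorem isSimpleRing (he : IsRankOneIdempotent k e) (hd : HasDualBases e)
    (hj : j ∈ sandwichIdeal e) (hc : ∀ x, j * x = x * j)
    (hone : ∀ y ∈ sandwichIdeal e, j * y = y) : IsSimpleRing (mulRightSubalgebra k j) := by
  have hmem : ∀ x, j * x = x → x ∈ mulRightSubalgebra k j := fun x hx => ⟨x, by rw [← hc, hx]⟩
  have hfix : ∀ x ∈ mulRightSubalgebra k j, x * j = x := by
    rintro _ ⟨a, rfl⟩
    rw [mul_assoc, hone j hj]
  have hemem := hmem e (hone e he.mem_sandwichIdeal)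
  have hnt : Nontrivial (mulRightSubalgebra k j) :=
    ⟨⟨⟨e, hemem⟩, 0, fun h => he.ne_zero (congrArg Subtype.val h)⟩⟩
  refine ⟨⟨fun I => or_iff_not_imp_left.2 fun hI => ?_⟩⟩
  obtain ⟨y, hyI, hy0⟩ : ∃ y ∈ I, y ≠ 0 := by
    by_contra! h
    exact hI (eq_bot_iff.2 fun y hy => by rw [TwoSidedIdeal.mem_bot]; exact h y hy)
  have hya : ∃ a, y.1 * (a * e) ≠ 0 := by
    by_contra! h
    apply hy0
    apply Subtype.ext
    rw [← hfix y.1 y.2]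
    exact mul_eq_zero_of_mem_sandwichIdeal h hj
  obtain ⟨a, ha⟩ := hya
  obtain ⟨b, hb⟩ := he.exists_mul_eq hd (a := y.1 * a) (by rwa [mul_assoc])
  have heI : (⟨e, hemem⟩ : mulRightSubalgebra k j) ∈ I := by
    have h1 : e * b ∈ sandwichIdeal e := sandwichIdeal_mul_mem he.mem_sandwichIdeal b
    have h2 : a * e ∈ sandwichIdeal e := mul_mem_sandwichIdeal a he.mem_sandwichIdeal
    have := I.mul_mem_right _ ⟨a * e, hmem _ (hone _ h2)⟩
      (I.mul_mem_left ⟨e * b, hmem _ (hone _ h1)⟩ _ hyI)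
    convert this using 1
    apply Subtype.ext
    change e = e * b * y.1 * (a * e)
    rw [mul_assoc (e * b), ← mul_assoc y.1, hb]
  have key : ∀ z ∈ sandwichIdeal e, ∀ hz : z ∈ mulRightSubalgebra k j,
      (⟨z, hz⟩ : mulRightSubalgebra k j) ∈ I := by
    intro z hz
    induction hz using AddSubgroup.closure_induction with
    | mem z hz =>
      obtain ⟨⟨p, q⟩, rfl⟩ := hz
      intro hz
      have h1 : p * e ∈ sandwichIdeal e := mul_mem_sandwichIdeal p he.mem_sandwichIdeal
      have h2 : e * q ∈ sandwichIdeal e := sandwichIdeal_mul_mem he.mem_sandwichIdeal q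
      -- The multipliers must lie in `A j`, so `p` and `q` are replaced by `p * e` and `e * q`.
      have := I.mul_mem_right _ ⟨e * q, hmem _ (hone _ h2)⟩
        (I.mul_mem_left ⟨p * e, hmem _ (hone _ h1)⟩ _ heI)
      convert this using 1
      apply Subtype.ext
      change p * e * q = p * e * e * (e * q)
      simp only [mul_assoc]
      rw [← mul_assoc e e q, he.mul_self, ← mul_assoc e e q, he.mul_self]
    | zero => intro _; exact I.zero_mem
    | add z z' hz hz' h h' =>
      intro _
      exact I.add_mem (h (hmem _ (hone _ hz))) (h' (hmem _ (hone _ hz')))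
    | neg z hz h =>
      intro _
      exact I.neg_mem (h (hmem _ (hone _ hz)))
  refine eq_top_iff.2 fun z _ => key z.1 ?_ z.2
  rw [← hfix z.1 z.2]
  exact mul_mem_sandwichIdeal _ hj

end Block

end IsRankOneIdempotent

/-! ### Möbius inversion on finite partial orders -/

section Moebius

open Finset

variable {α R : Type*} [PartialOrder α] [Fintype α]

/-- On a finite partial order, a function is zero when its sums over all principal ideals are. -/
theorem eq_zero_of_forall_sum_le_eq_zero [AddCommMonoid R] [DecidableLE α] {f : α → R}
    (h : ∀ x, ∑ y with y ≤ x, f y = 0) (x : α) : f x = 0 := by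
  induction x using WellFoundedLT.induction with
  | ind x ih =>
    rw [← h x]
    refine (sum_eq_single x (fun y hy hyx => ?_) (fun hx => ?_)).symm
    · exact ih y (lt_of_le_of_ne (mem_filter.1 hy).2 hyx)
    · exact (hx (mem_filter.2 ⟨mem_univ x, le_rfl⟩)).elim

variable [CommRing R] [LocallyFiniteOrder α] [DecidableEq α] [DecidableLE α]

theorem exists_forall_sum_le_eq (g : α → R) : ∃ f : α → R, ∀ x, ∑ y with y ≤ x, f y = g x := by
  refine ⟨fun x => ∑ y, (IncidenceAlgebra.mu ℤ y x : R) * g y, fun v => ?_⟩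
  rw [sum_comm]
  have key : ∀ y, ∑ x with x ≤ v, (IncidenceAlgebra.mu ℤ y x : R) = if y = v then 1 else 0 := by
    intro y
    have h1 : ∑ x with x ≤ v, IncidenceAlgebra.mu ℤ y x = if y = v then 1 else 0 := by
      rw [← IncidenceAlgebra.sum_Icc_mu_right]
      refine (sum_subset (fun x hx => ?_) fun x hx hx' => ?_).symm
      · exact mem_filter.2 ⟨mem_univ x, (mem_Icc.1 hx).2⟩
      · refine IncidenceAlgebra.apply_eq_zero_of_not_le (fun h => hx' ?_) _
        exact mem_Icc.2 ⟨h, (mem_filter.1 hx).2⟩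
    have h2 := congrArg (Int.cast : ℤ → R) h1
    push_cast at h2
    exact h2
  simp only [← sum_mul, key, ite_mul, one_mul, zero_mul, sum_ite_eq', mem_univ, if_true]

/-- Möbius inversion evaluated at the top element only, which is the form in which the totient is
defined. -/
theorem sum_mu_top_mul_eq [OrderTop α] {f g : α → R} (h : ∀ x, ∑ y with y ≤ x, f y = g x) :
    ∑ x, (IncidenceAlgebra.mu ℤ x ⊤ : R) * g x = f ⊤ := by
  have key : ∀ y : α, ∑ x with y ≤ x, (IncidenceAlgebra.mu ℤ x ⊤ : R) =
      if y = ⊤ then 1 else 0 := by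
    intro y
    have h1 : ∑ x with y ≤ x, IncidenceAlgebra.mu ℤ x ⊤ = if y = ⊤ then 1 else 0 := by
      rw [← IncidenceAlgebra.sum_Icc_mu_left]
      refine sum_congr (ext fun x => ?_) fun _ _ => rfl
      simp
    have h2 := congrArg (Int.cast : ℤ → R) h1
    push_cast at h2
    exact h2
  calc ∑ x, (IncidenceAlgebra.mu ℤ x ⊤ : R) * g x
      = ∑ x, ∑ y, if y ≤ x then (IncidenceAlgebra.mu ℤ x ⊤ : R) * f y else 0 := by
        refine sum_congr rfl fun x _ => ?_
        rw [← h, mul_sum, sum_filter]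
    _ = ∑ y, (∑ x with y ≤ x, (IncidenceAlgebra.mu ℤ x ⊤ : R)) * f y := by
        rw [sum_comm]
        refine sum_congr rfl fun y _ => ?_
        rw [sum_mul, sum_filter]
    _ = f ⊤ := by simp [key]

/-- A matrix indexed by a finite meet semilattice, with entries depending only on meets, is
non-degenerate when the Möbius inverse of the function defining it does not vanish. -/
theorem eq_zero_of_forall_sum_inf_eq_zero {K L : Type*} [Field K] [SemilatticeInf L] [Fintype L]
    [DecidableLE L] {f g : L → K} (hfg : ∀ x, ∑ y with y ≤ x, f y = g x) (hf : ∀ x, f x ≠ 0)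
    {c : L → K} (hc : ∀ x, ∑ y, g (x ⊓ y) * c y = 0) (x : L) : c x = 0 := by
  -- Expand `g (x ⊓ y)` as the sum of `f w` over `w ≤ x` and `w ≤ y`. The hypothesis says that the
  -- sums of this function of `w` over principal ideals vanish, so the function itself does.
  have h1 : ∀ w, f w * ∑ y with w ≤ y, c y = 0 := by
    refine eq_zero_of_forall_sum_le_eq_zero fun x => ?_
    rw [← hc x]
    simp only [← hfg, sum_filter, sum_mul, mul_sum]
    rw [sum_comm' (t' := univ) (s' := fun _ => univ) (by simp)]
    refine (sum_congr rfl fun w _ => ?_)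
    by_cases hw : w ≤ x
    · simp only [hw, if_true, le_inf_iff, true_and]
      refine sum_congr rfl fun y _ => ?_
      split_ifs <;> simp
    · simp [hw]
  have h2 : ∀ w, ∑ y with w ≤ y, c y = 0 := fun w => (mul_eq_zero.1 (h1 w)).resolve_left (hf w)
  -- The second inversion runs upwards, hence in the dual order.
  exact eq_zero_of_forall_sum_le_eq_zero (α := Lᵒᵈ) (f := fun y => c (OrderDual.ofDual y)) h2 x

end Moebius

/-! ### The totient and the matrix of intersections of subgroups -/

namespace SubgroupCategory

open Finset

variable {𝕂 : Type u} [Field 𝕂] (ℓ : ℕ+ →* 𝕂ˣ)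

theorem ellGroup_congr {G H : Type*} [Group G] [Group H] [Finite G] [Finite H]
    (h : Nat.card G = Nat.card H) : ellGroup ℓ G = ellGroup ℓ H := by
  rw [ellGroup, ellGroup]
  congr 2

theorem ellGroup_eq_one {G : Type*} [Group G] [Finite G] (h : Nat.card G = 1) :
    ellGroup ℓ G = 1 := by
  rw [ellGroup, ← map_one ℓ]
  congr 1
  exact PNat.eq h

/-- The totient function satisfies `ℓ(B) = ∑ φ(U)`, the sum being over the subgroups of `B`. -/
theorem sum_totient_eq_ellGroup (G : Type*) [Group G] [Finite G] [Fintype (Subgroup G)]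
    [DecidableLE (Subgroup G)] (B : Subgroup G) :
    ∑ U with U ≤ B, totient ℓ (U : Subgroup G) = (ellGroup ℓ B : 𝕂) := by
  classical
  let : LocallyFiniteOrder (Subgroup G) := Fintype.toLocallyFiniteOrder
  obtain ⟨f, hf⟩ := exists_forall_sum_le_eq fun V : Subgroup G => (ellGroup ℓ V : 𝕂)
  -- The totient of `V` is computed in the subgroup lattice of `V`, which is identified by `map
  -- V.subtype` with the interval below `V` in that of `G`.
  have key : ∀ V : Subgroup G, totient ℓ V = f V := by
    intro V
    rw [totient]
    let : Fintype (Subgroup V) := Fintype.ofFinite (Subgroup V)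
    let : LocallyFiniteOrder (Subgroup V) := Fintype.toLocallyFiniteOrder
    have hV : ∀ U : Subgroup V, ∑ W with W ≤ U, f (W.map V.subtype) = (ellGroup ℓ U : 𝕂) := by
      intro U
      rw [ellGroup_congr ℓ (Subgroup.card_map_of_injective (K := U) V.subtype_injective).symm,
        ← hf]
      refine sum_bij (fun W _ => W.map V.subtype) (fun W hW => ?_) (fun W _ W' _ h => ?_)
        (fun W hW => ?_) (fun _ _ => rfl)
      · exact mem_filter.2 ⟨mem_univ _, Subgroup.map_mono (mem_filter.1 hW).2⟩
      · exact Subgroup.map_injective V.subtype_injective h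
      · have hWU := (mem_filter.1 hW).2
        have hWV : W ≤ V := hWU.trans (Subgroup.map_subtype_le U)
        have hmap : (W.subgroupOf V).map V.subtype = W := by
          rw [Subgroup.subgroupOf_map_subtype, inf_eq_left.2 hWV]
        refine ⟨W.subgroupOf V, mem_filter.2 ⟨mem_univ _, ?_⟩, hmap⟩
        rwa [← Subgroup.map_le_map_iff_of_injective V.subtype_injective, hmap]
    have := sum_mu_top_mul_eq hV
    rw [← MonoidHom.range_eq_map, Subgroup.range_subtype] at this
    rw [← this]
  simp only [key, hf]

/-- If the totient function does not vanish on the subgroups of `G`, then the matrix with entries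
`ℓ(B ∩ C)` is invertible. -/
theorem exists_inverse_ellGroup_inf (G : Type*) [Group G] [Finite G] [Fintype (Subgroup G)]
    [DecidableEq (Subgroup G)] (hφ : ∀ B : Subgroup G, totient ℓ B ≠ 0) :
    ∃ Q : Matrix (Subgroup G) (Subgroup G) 𝕂,
      Q * Matrix.of (fun B C : Subgroup G => (ellGroup ℓ ↥(B ⊓ C) : 𝕂)) = 1 ∧
      Matrix.of (fun B C : Subgroup G => (ellGroup ℓ ↥(B ⊓ C) : 𝕂)) * Q = 1 := by
  classical
  set P := Matrix.of fun B C : Subgroup G => (ellGroup ℓ ↥(B ⊓ C) : 𝕂) with hP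
  have hdet : IsUnit P.det := by
    rw [isUnit_iff_ne_zero]
    intro h
    obtain ⟨c, hc0, hc⟩ := Matrix.exists_mulVec_eq_zero_iff.2 h
    refine hc0 (funext fun C => ?_)
    exact eq_zero_of_forall_sum_inf_eq_zero (f := fun B : Subgroup G => totient ℓ B)
      (g := fun B : Subgroup G => (ellGroup ℓ B : 𝕂)) (sum_totient_eq_ellGroup ℓ G) hφ
      (fun B => congrFun hc B) C
  exact ⟨P⁻¹, Matrix.nonsing_inv_mul P hdet, Matrix.mul_nonsing_inv P hdet⟩

end SubgroupCategory

/-! ### The simple quotient of the left ideal of a rank one idempotent -/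

/-- The elements `a` such that `a e` is annihilated by `e A`. -/
def dualAnnihilator {A : Type*} [NonUnitalRing A] (e : A) : AddSubgroup A where
  carrier := {a | ∀ b, e * b * (a * e) = 0}
  add_mem' {x y} hx hy b := by rw [add_mul, mul_add, hx, hy, add_zero]
  zero_mem' b := by rw [zero_mul, mul_zero]
  neg_mem' {x} hx b := by rw [neg_mul, mul_neg, hx, neg_zero]

namespace IsRankOneIdempotent

open LUModule

variable {k A : Type*} [Field k] [NonUnitalRing A] [Module k A] {e : A}

/-- The action of `A` on the quotient of `A` by `dualAnnihilator e`. -/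
@[reducible]
def quotientModule (he : IsRankOneIdempotent k e) : LUModule A (A ⧸ dualAnnihilator e) where
  smul a := QuotientAddGroup.map (dualAnnihilator e) (dualAnnihilator e)
    (AddMonoidHom.mulLeft a) fun x hx b => by
    change e * b * (a * x * e) = 0
    rw [mul_assoc a, ← mul_assoc (e * b), mul_assoc e b a]
    exact hx (b * a)
  smul_add' a x y := map_add _ x y
  add_smul' a b x := by
    obtain ⟨x, rfl⟩ := QuotientAddGroup.mk_surjective x
    exact congrArg QuotientAddGroup.mk (add_mul a b x)
  mul_smul' a b x := by
    obtain ⟨x, rfl⟩ := QuotientAddGroup.mk_surjective x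
    exact congrArg QuotientAddGroup.mk (mul_assoc a b x)
  exists_idempotent x := by
    obtain ⟨x, rfl⟩ := QuotientAddGroup.mk_surjective x
    obtain ⟨f, hf, hfx⟩ := he.exists_unit x
    exact ⟨f, hf, congrArg QuotientAddGroup.mk hfx⟩

/-- Since `(a - a * e) * e = 0`, the quotient of `A` is in fact a quotient of `A e`. -/
theorem mk_mul_self (he : IsRankOneIdempotent k e) (a : A) :
    ((a * e : A) : A ⧸ dualAnnihilator e) = a := by
  rw [QuotientAddGroup.eq]
  intro b
  rw [add_mul, neg_mul, mul_assoc a, he.mul_self, neg_add_cancel, mul_zero]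

theorem mk_eq_zero_iff {e a : A} :
    (a : A ⧸ dualAnnihilator e) = 0 ↔ ∀ b, e * b * (a * e) = 0 :=
  QuotientAddGroup.eq_zero_iff a

/-- A class that is not zero pairs with some `e * b` to a non-zero multiple of `e`. So every
non-zero submodule contains the class of `e`, and that class generates. -/
theorem isSimple_quotient [IsScalarTower k A A] [SMulCommClass k A A]
    (he : IsRankOneIdempotent k e) :
    @IsSimple A (A ⧸ dualAnnihilator e) _ _ he.quotientModule := by
  let := he.quotientModule
  refine ⟨⟨⟨(e : A), 0, fun h => he.ne_zero ?_⟩⟩, fun N hN => or_iff_not_imp_left.2 fun h => ?_⟩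
  · have := mk_eq_zero_iff.1 h e
    rwa [he.mul_self, he.mul_self] at this
  · obtain ⟨⟨x, hxN⟩, hx⟩ := AddSubgroup.ne_bot_iff_exists_ne_zero.1 h
    have hx0 : x ≠ 0 := fun h0 => hx (Subtype.ext h0)
    obtain ⟨a, rfl⟩ := QuotientAddGroup.mk_surjective x
    rw [ne_eq, mk_eq_zero_iff] at hx0
    push Not at hx0
    obtain ⟨b, hb⟩ := hx0
    obtain ⟨c, hc⟩ := he.corner (b * a)
    have hc' : e * b * a * e = c • e := by rw [← hc]; simp only [mul_assoc]
    have hc0 : c ≠ 0 := by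
      rintro rfl
      exact hb (by rw [← mul_assoc, hc', zero_smul])
    have heN : ((e : A) : A ⧸ dualAnnihilator e) ∈ N := by
      have h1 := hN (c⁻¹ • (e * b)) _ hxN
      have h2 : (c⁻¹ • (e * b)) • (a : A ⧸ dualAnnihilator e) = (e : A) := by
        change ((c⁻¹ • (e * b) * a : A) : A ⧸ dualAnnihilator e) = (e : A)
        rw [← he.mk_mul_self, smul_mul_assoc, smul_mul_assoc, hc', smul_smul,
          inv_mul_cancel₀ hc0, one_smul]
      rwa [h2] at h1
    refine eq_top_iff.2 fun y _ => ?_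
    obtain ⟨y, rfl⟩ := QuotientAddGroup.mk_surjective y
    rw [← he.mk_mul_self]
    exact hN y _ heN

end IsRankOneIdempotent

namespace SubgroupCategory

open LUModule

/-! ### Star products with direct products -/

section Star

variable {R S T : Type*} [Group R] [Group S] [Group T]

/-- The second factor of a direct product survives star multiplication from the left, so the span of
the `s_{C × D}` with `D` fixed is a left ideal. `prod_star` is the mirror image. -/
theorem star_prod (U : Subgroup (R × S)) (C : Subgroup S) (D : Subgroup T) :
    star U (C.prod D) = (leftKer (star U (C.prod D))).prod D := by
  ext ⟨r, t⟩
  simp only [Subgroup.mem_prod, mem_leftKer, mem_star]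
  constructor
  · rintro ⟨s, h₁, h₂, h₃⟩
    exact ⟨⟨s, h₁, h₂, D.one_mem⟩, h₃⟩
  · rintro ⟨⟨s, h₁, h₂, -⟩, h₃⟩
    exact ⟨s, h₁, h₂, h₃⟩

theorem prod_star (A : Subgroup R) (B : Subgroup S) (U : Subgroup (S × T)) :
    star (A.prod B) U = A.prod (rightKer (star (A.prod B) U)) := by
  ext ⟨r, t⟩
  simp only [Subgroup.mem_prod, mem_rightKer, mem_star]
  constructor
  · rintro ⟨s, ⟨h₁, h₂⟩, h₃⟩
    exact ⟨h₁, s, ⟨A.one_mem, h₂⟩, h₃⟩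
  · rintro ⟨h₁, s, ⟨-, h₂⟩, h₃⟩
    exact ⟨s, ⟨h₁, h₂⟩, h₃⟩

theorem prod_star_prod (A : Subgroup R) (B C : Subgroup S) (D : Subgroup T) :
    star (A.prod B) (C.prod D) = A.prod D := by
  ext ⟨r, t⟩
  simp only [Subgroup.mem_prod, mem_star]
  constructor
  · rintro ⟨s, ⟨h₁, -⟩, -, h₂⟩
    exact ⟨h₁, h₂⟩
  · rintro ⟨h₁, h₂⟩
    exact ⟨1, ⟨h₁, B.one_mem⟩, C.one_mem, h₂⟩

theorem rightKer_prod (A : Subgroup R) (B : Subgroup S) : rightKer (A.prod B) = B := by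
  ext s
  simp only [mem_rightKer, Subgroup.mem_prod]
  exact ⟨fun h => h.2, fun h => ⟨A.one_mem, h⟩⟩

theorem leftKer_prod (A : Subgroup R) (B : Subgroup S) : leftKer (A.prod B) = A := by
  ext s
  simp only [mem_leftKer, Subgroup.mem_prod]
  exact ⟨fun h => h.1, fun h => ⟨h, B.one_mem⟩⟩

theorem mem_diag {x y : R} : (x, y) ∈ diag R ↔ x = y := by
  constructor
  · rintro ⟨z, hz⟩
    exact (congrArg Prod.fst hz).symm.trans (congrArg Prod.snd hz)
  · rintro rfl
    exact ⟨x, rfl⟩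

theorem diag_star (U : Subgroup (R × S)) : star (diag R) U = U := by
  ext ⟨r, s⟩
  simp [mem_star, mem_diag]

theorem star_diag (U : Subgroup (R × S)) : star U (diag S) = U := by
  ext ⟨r, s⟩
  simp [mem_star, mem_diag]

theorem rightKer_diag : rightKer (diag R) = ⊥ := by
  ext r
  rw [mem_rightKer, mem_diag, Subgroup.mem_bot, eq_comm]

theorem leftKer_diag : leftKer (diag R) = ⊥ := by
  ext r
  rw [mem_leftKer, mem_diag, Subgroup.mem_bot]

end Star

variable {𝕂 : Type u} [Field 𝕂] (ℓ : ℕ+ →* 𝕂ˣ) {𝒦 : Set FiniteGrp.{v}}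

theorem lam_induction {p : Lam ℓ 𝒦 → Prop} (zero : p 0)
    (add : ∀ a b, p a → p b → p (a + b)) (smul : ∀ (c : 𝕂) (U : Mor 𝒦), p (c • sq ℓ U))
    (a : Lam ℓ 𝒦) : p a := by
  refine Finsupp.induction_linear (motive := p) a zero (fun f g hf hg => add f g hf hg)
    fun U c => ?_
  have h : (Finsupp.single U c : Mor 𝒦 →₀ 𝕂) = c • (Finsupp.single U (1 : 𝕂)) := by
    rw [Finsupp.smul_single, smul_eq_mul, mul_one]
  rw [h]
  exact smul c U

theorem sq_ne_zero (U : Mor 𝒦) : sq ℓ U ≠ 0 := fun h =>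
  one_ne_zero (Finsupp.single_eq_zero.1 h : (1 : 𝕂) = 0)

/-! ### Local units -/

theorem idElem_mul_sq {G H : 𝒦} (U : Subgroup (G.1 × H.1)) :
    idElem ℓ G * sq ℓ ⟨G, H, U⟩ = sq ℓ ⟨G, H, U⟩ := by
  rw [idElem, sq_mul_sq, diag_star, cocycle, ellGroup_eq_one, Units.val_one, one_smul]
  rw [rightKer_diag, bot_inf_eq, Subgroup.card_bot]

theorem sq_mul_idElem {G H : 𝒦} (U : Subgroup (G.1 × H.1)) :
    sq ℓ ⟨G, H, U⟩ * idElem ℓ H = sq ℓ ⟨G, H, U⟩ := by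
  rw [idElem, sq_mul_sq, star_diag, cocycle, ellGroup_eq_one, Units.val_one, one_smul]
  rw [leftKer_diag, inf_bot_eq, Subgroup.card_bot]

/-- The sum of the idempotents `id_G` over a finite set of groups `G`. -/
noncomputable def idSum (s : Finset 𝒦) : Lam ℓ 𝒦 := ∑ G ∈ s, idElem ℓ G

theorem idSum_mul_sq {s : Finset 𝒦} {U : Mor 𝒦} (h : U.cod ∈ s) :
    idSum ℓ s * sq ℓ U = sq ℓ U := by
  rw [idSum, Finset.sum_mul]
  refine (Finset.sum_eq_single U.cod (fun G _ hG => ?_) fun hU => absurd h hU).trans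
    (idElem_mul_sq ℓ U.sub)
  exact sq_mul_sq_of_ne ℓ (U := ⟨G, G, diag G.1⟩) hG.symm

theorem sq_mul_idSum {s : Finset 𝒦} {U : Mor 𝒦} (h : U.dom ∈ s) :
    sq ℓ U * idSum ℓ s = sq ℓ U := by
  rw [idSum, Finset.mul_sum]
  refine (Finset.sum_eq_single U.dom (fun G _ hG => ?_) fun hU => absurd h hU).trans
    (sq_mul_idElem ℓ U.sub)
  exact sq_mul_sq_of_ne ℓ (V := ⟨G, G, diag G.1⟩) hG

theorem isIdempotentElem_idSum (s : Finset 𝒦) : IsIdempotentElem (idSum ℓ s) := by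
  rw [IsIdempotentElem]
  nth_rewrite 2 3 [idSum]
  rw [Finset.mul_sum]
  exact Finset.sum_congr rfl fun G hG => idSum_mul_sq ℓ (U := ⟨G, G, diag G.1⟩) hG

/-- Allowing every larger `t` lets the finite sets of two summands be merged. -/
theorem exists_idSum_mul (a : Lam ℓ 𝒦) : ∃ s, ∀ t, s ⊆ t → idSum ℓ t * a = a := by
  classical
  induction a using lam_induction with
  | zero => exact ⟨∅, fun t _ => mul_zero _⟩
  | add a b ha hb =>
    obtain ⟨s, hs⟩ := ha
    obtain ⟨s', hs'⟩ := hb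
    refine ⟨s ∪ s', fun t ht => ?_⟩
    rw [mul_add, hs t (Finset.union_subset_left ht), hs' t (Finset.union_subset_right ht)]
  | smul c U =>
    refine ⟨{U.cod}, fun t ht => ?_⟩
    rw [mul_smul_comm, idSum_mul_sq ℓ (ht (Finset.mem_singleton_self _))]

theorem exists_unit_of_finite (h : 𝒦.Finite) : ∃ i : Lam ℓ 𝒦, ∀ a, i * a = a ∧ a * i = a := by
  have := h.fintype
  refine ⟨idSum ℓ Finset.univ, fun a => ?_⟩
  induction a using lam_induction with
  | zero => exact ⟨mul_zero _, zero_mul _⟩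
  | add a b ha hb => exact ⟨by rw [mul_add, ha.1, hb.1], by rw [add_mul, ha.2, hb.2]⟩
  | smul c U =>
    exact ⟨by rw [mul_smul_comm, idSum_mul_sq ℓ (Finset.mem_univ _)],
      by rw [smul_mul_assoc, sq_mul_idSum ℓ (Finset.mem_univ _)]⟩

/-! ### Basis elements indexed by direct products -/

/-- The basis element of `Λ` indexed by the subgroup `A × B` of `F × G`. -/
noncomputable def rect {F G : 𝒦} (A : Subgroup F.1) (B : Subgroup G.1) : Lam ℓ 𝒦 :=
  sq ℓ ⟨F, G, A.prod B⟩

/-- The inner subgroups contribute only the scalar `ℓ(B ∩ C)`: this is where the Gram matrix arises.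
-/
theorem rect_mul_rect {F G H : 𝒦} (A : Subgroup F.1) (B C : Subgroup G.1) (D : Subgroup H.1) :
    rect ℓ A B * rect ℓ C D = (ellGroup ℓ ↥(B ⊓ C) : 𝕂) • rect ℓ A D := by
  rw [rect, rect, sq_mul_sq, prod_star_prod, cocycle, rect,
    ellGroup_congr ℓ (H := ↥(B ⊓ C)) (by rw [rightKer_prod, leftKer_prod])]

theorem ellGroup_bot_inf {G : Type*} [Group G] [Finite G] (B : Subgroup G) :
    ellGroup ℓ ↥(⊥ ⊓ B) = 1 := ellGroup_eq_one ℓ (by rw [bot_inf_eq, Subgroup.card_bot])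

theorem rect_bot_mul_rect {F G H : 𝒦} (A : Subgroup F.1) (C : Subgroup G.1) (D : Subgroup H.1) :
    rect ℓ A (⊥ : Subgroup G.1) * rect ℓ C D = rect ℓ A D := by
  rw [rect_mul_rect, ellGroup_bot_inf, Units.val_one, one_smul]

/-- The idempotent of `Λ` indexed by the trivial subgroup of `F × F`. -/
noncomputable def botElem (F : 𝒦) : Lam ℓ 𝒦 := rect ℓ (⊥ : Subgroup F.1) (⊥ : Subgroup F.1)

theorem mul_rect_mem_span {F G : 𝒦} (A : Subgroup F.1) (B : Subgroup G.1) (a : Lam ℓ 𝒦) :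
    a * rect ℓ A B ∈ Submodule.span 𝕂 {z | ∃ (H : 𝒦) (C : Subgroup H.1), z = rect ℓ C B} := by
  induction a using lam_induction with
  | zero => rw [zero_mul]; exact zero_mem _
  | add a b ha hb => rw [add_mul]; exact add_mem ha hb
  | smul c U =>
    rw [smul_mul_assoc]
    refine Submodule.smul_mem _ _ ?_
    obtain ⟨H, F', U⟩ := U
    by_cases h : F = F'
    · subst h
      rw [rect, sq_mul_sq, star_prod]
      exact Submodule.smul_mem _ _ (Submodule.subset_span ⟨H, _, rfl⟩)
    · rw [rect, sq_mul_sq_of_ne ℓ (U := ⟨H, F', U⟩) h]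
      exact zero_mem _

theorem rect_mul_mem_span {F G : 𝒦} (A : Subgroup F.1) (B : Subgroup G.1) (a : Lam ℓ 𝒦) :
    rect ℓ A B * a ∈ Submodule.span 𝕂 {z | ∃ (H : 𝒦) (C : Subgroup H.1), z = rect ℓ A C} := by
  induction a using lam_induction with
  | zero => rw [mul_zero]; exact zero_mem _
  | add a b ha hb => rw [mul_add]; exact add_mem ha hb
  | smul c U =>
    rw [mul_smul_comm]
    refine Submodule.smul_mem _ _ ?_
    obtain ⟨G', H, U⟩ := U
    by_cases h : G' = G
    · subst h
      rw [rect, sq_mul_sq, prod_star]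
      exact Submodule.smul_mem _ _ (Submodule.subset_span ⟨H, _, rfl⟩)
    · rw [rect, sq_mul_sq_of_ne ℓ (V := ⟨G', H, U⟩) h]
      exact zero_mem _

/-- A product `e * a` is a combination of elements `s_{1 × C}`, and each of these times `e` is a
multiple of `e`, or zero when the groups do not match. -/
theorem isRankOneIdempotent_botElem (F : 𝒦) : IsRankOneIdempotent 𝕂 (botElem ℓ F) where
  mul_self := rect_bot_mul_rect ℓ _ _ _
  ne_zero := sq_ne_zero ℓ _
  corner a := by
    have h := rect_mul_mem_span ℓ (⊥ : Subgroup F.1) (⊥ : Subgroup F.1) a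
    change ∃ c : 𝕂, rect ℓ _ _ * a * _ = _
    generalize rect ℓ (⊥ : Subgroup F.1) (⊥ : Subgroup F.1) * a = y at h ⊢
    induction h using Submodule.span_induction with
    | mem x hx =>
      obtain ⟨H, C, rfl⟩ := hx
      by_cases hH : F = H
      · subst hH
        exact ⟨_, rect_mul_rect ℓ _ _ _ _⟩
      · exact ⟨0, by
          rw [zero_smul]
          exact sq_mul_sq_of_ne ℓ (U := ⟨F, H, _⟩) hH⟩
    | zero => exact ⟨0, by rw [zero_smul, zero_mul]⟩
    | add x y _ _ hx hy =>
      obtain ⟨c, hc⟩ := hx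
      obtain ⟨d, hd⟩ := hy
      exact ⟨c + d, by rw [add_mul, hc, hd, add_smul]⟩
    | smul d x _ hx =>
      obtain ⟨c, hc⟩ := hx
      exact ⟨d * c, by rw [smul_mul_assoc, hc, smul_smul]⟩
  exists_unit a := by
    obtain ⟨s, hs⟩ := exists_idSum_mul ℓ a
    exact ⟨idSum ℓ s, isIdempotentElem_idSum ℓ s, hs s subset_rfl⟩

/-- With `Q` inverse to the matrix `P` of the `ℓ(B ∩ C)`, the element is `∑ Q(B, C) s_{B × C}`. It
lies in the ideal because `s_{B × C} = s_{B × 1} e s_{1 × C}`. Its action on `Λe` is that of `id_G`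
by `Q P = 1`, and on `eΛ` by `P Q = 1`. -/
theorem exists_mem_sandwichIdeal_idElem (F G : 𝒦) (hφ : ∀ B : Subgroup G.1, totient ℓ B ≠ 0) :
    ∃ j ∈ sandwichIdeal (botElem ℓ F),
      (∀ a, idElem ℓ G * (a * botElem ℓ F) = j * (a * botElem ℓ F)) ∧
      ∀ b, botElem ℓ F * b * idElem ℓ G = botElem ℓ F * b * j := by
  classical
  have := Fintype.ofFinite (Subgroup G.1)
  obtain ⟨Q, hQP, hPQ⟩ := exists_inverse_ellGroup_inf ℓ G.1 hφ
  refine ⟨∑ B, ∑ C, Q B C • rect ℓ B C, ?_, fun a => ?_, fun b => ?_⟩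
  · refine sum_mem fun B _ => sum_mem fun C _ => AddSubgroup.subset_closure
      ⟨(Q B C • rect ℓ B (⊥ : Subgroup F.1), rect ℓ (⊥ : Subgroup F.1) C), ?_⟩
    change Q B C • rect ℓ B (⊥ : Subgroup F.1) * botElem ℓ F * rect ℓ (⊥ : Subgroup F.1) C = _
    rw [smul_mul_assoc, smul_mul_assoc, botElem, rect_bot_mul_rect, rect_bot_mul_rect]
  · have h := mul_rect_mem_span ℓ (⊥ : Subgroup F.1) (⊥ : Subgroup F.1) a
    rw [← botElem] at h
    generalize a * botElem ℓ F = y at h ⊢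
    induction h using Submodule.span_induction with
    | mem x hx =>
      obtain ⟨H, D, rfl⟩ := hx
      by_cases hH : H = G
      · subst hH
        rw [rect, idElem_mul_sq, ← rect]
        simp only [Finset.sum_mul, smul_mul_assoc, rect_mul_rect, smul_smul, ← Finset.sum_smul]
        have hB : ∀ B : Subgroup H.1, ∑ C, Q B C * (ellGroup ℓ ↥(C ⊓ D) : 𝕂) =
            if B = D then 1 else 0 := fun B => congrFun (congrFun hQP B) D
        simp only [hB, ite_smul, one_smul, zero_smul, Finset.sum_ite_eq', Finset.mem_univ,
          if_true]
      · rw [rect, idElem, sq_mul_sq_of_ne ℓ (U := ⟨G, G, _⟩) hH, Finset.sum_mul]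
        refine (Finset.sum_eq_zero fun B _ => ?_).symm
        rw [Finset.sum_mul]
        refine Finset.sum_eq_zero fun C _ => ?_
        rw [smul_mul_assoc, rect, sq_mul_sq_of_ne ℓ (U := ⟨G, G, _⟩) hH, smul_zero]
    | zero => rw [mul_zero, mul_zero]
    | add x y _ _ hx hy => rw [mul_add, mul_add, hx, hy]
    | smul d x _ hx => rw [mul_smul_comm, mul_smul_comm, hx]
  · have h := rect_mul_mem_span ℓ (⊥ : Subgroup F.1) (⊥ : Subgroup F.1) b
    rw [← botElem] at h
    generalize botElem ℓ F * b = y at h ⊢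
    induction h using Submodule.span_induction with
    | mem x hx =>
      obtain ⟨H, D, rfl⟩ := hx
      by_cases hH : G = H
      · subst hH
        rw [rect, sq_mul_idElem, ← rect, Finset.sum_comm]
        simp only [Finset.mul_sum, mul_smul_comm, rect_mul_rect, smul_smul, ← Finset.sum_smul]
        have hB : ∀ C : Subgroup G.1, ∑ B, Q B C * (ellGroup ℓ ↥(D ⊓ B) : 𝕂) =
            if D = C then 1 else 0 := fun C => by
          simp only [mul_comm (Q _ _)]
          exact congrFun (congrFun hPQ D) C
        simp only [hB, ite_smul, one_smul, zero_smul, Finset.sum_ite_eq, Finset.mem_univ,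
          if_true]
      · rw [rect, idElem, sq_mul_sq_of_ne ℓ (V := ⟨G, G, _⟩) hH, Finset.mul_sum]
        refine (Finset.sum_eq_zero fun B _ => ?_).symm
        rw [Finset.mul_sum]
        refine Finset.sum_eq_zero fun C _ => ?_
        rw [mul_smul_comm, rect, sq_mul_sq_of_ne ℓ (V := ⟨G, G, _⟩) hH, smul_zero]
    | zero => rw [zero_mul, zero_mul]
    | add x y _ _ hx hy => rw [add_mul, add_mul, hx, hy]
    | smul d x _ hx => rw [smul_mul_assoc, smul_mul_assoc, hx]

theorem hasDualBases_botElem (hφ : ∀ G ∈ 𝒦, ∀ B : Subgroup G, totient ℓ B ≠ 0) (F : 𝒦) :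
    HasDualBases (botElem ℓ F) := by
  intro x
  induction x using lam_induction with
  | zero => exact ⟨0, zero_mem _, fun a => rfl, fun b => rfl⟩
  | add x y hx hy =>
    obtain ⟨j, hj, hl, hr⟩ := hx
    obtain ⟨j', hj', hl', hr'⟩ := hy
    exact ⟨j + j', add_mem hj hj', fun a => by rw [add_mul, hl, hl', add_mul],
      fun b => by rw [mul_add, hr, hr', mul_add]⟩
  | smul c U =>
    obtain ⟨j, hj, hl, hr⟩ := exists_mem_sandwichIdeal_idElem ℓ F U.cod (hφ _ U.cod.2)
    have hU : idElem ℓ U.cod * (c • sq ℓ U) = c • sq ℓ U := by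
      rw [mul_smul_comm]
      exact congrArg (c • ·) (idElem_mul_sq ℓ U.sub)
    -- The morphism absorbs the identity of its codomain on the left, and `j` stands in for that
    -- identity.
    refine ⟨j * (c • sq ℓ U), sandwichIdeal_mul_mem hj _, fun a => ?_, fun b => ?_⟩
    · rw [mul_assoc j, ← mul_assoc _ a, ← hl, ← mul_assoc, ← mul_assoc, hU]
    · rw [← mul_assoc _ j, ← hr, mul_assoc _ (idElem ℓ U.cod), hU]

end SubgroupCategory

namespace SubgroupCategory

open LUModule

variable {𝕂 : Type u} [Field 𝕂] (ℓ : ℕ+ →* 𝕂ˣ) {𝒦 𝒦' : Set FiniteGrp.{v}}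

/-! ### Enlarging the set of groups -/

theorem incl_sq (h : 𝒦 ⊆ 𝒦') (U : Mor 𝒦) :
    incl ℓ h (sq ℓ U) = sq ℓ ⟨⟨U.cod.1, h U.cod.2⟩, ⟨U.dom.1, h U.dom.2⟩, U.sub⟩ :=
  linExt_sq ℓ _ U

theorem incl_botElem (h : 𝒦 ⊆ 𝒦') (F : 𝒦) :
    incl ℓ h (botElem ℓ F) = botElem ℓ ⟨F.1, h F.2⟩ := incl_sq ℓ h _

theorem incl_mul (h : 𝒦 ⊆ 𝒦') (a b : Lam ℓ 𝒦) : incl ℓ h (a * b) = incl ℓ h a * incl ℓ h b := by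
  induction a using lam_induction with
  | zero => rw [zero_mul, map_zero, zero_mul]
  | add a a' ha ha' => rw [add_mul, map_add, map_add, add_mul, ha, ha']
  | smul c U =>
    induction b using lam_induction with
    | zero => rw [mul_zero, map_zero, mul_zero]
    | add b b' hb hb' => rw [mul_add, map_add, map_add, mul_add, hb, hb']
    | smul d V =>
      rw [smul_mul_assoc, mul_smul_comm, map_smul, map_smul, map_smul, map_smul, smul_mul_assoc,
        mul_smul_comm]
      congr 2
      obtain ⟨F, G, U⟩ := U
      obtain ⟨G', H, V⟩ := V
      by_cases hG : G' = G
      · subst hG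
        rw [sq_mul_sq, map_smul, incl_sq, incl_sq, incl_sq]
        exact (sq_mul_sq ℓ (F := ⟨F.1, h F.2⟩) (G := ⟨G'.1, h G'.2⟩) (H := ⟨H.1, h H.2⟩) U V).symm
      · rw [sq_mul_sq_of_ne ℓ (U := ⟨F, G, U⟩) (V := ⟨G', H, V⟩) hG, map_zero, incl_sq, incl_sq,
          sq_mul_sq_of_ne]
        exact fun h' : (⟨G'.1, h G'.2⟩ : 𝒦') = ⟨G.1, h G.2⟩ => hG (Subtype.ext (Subtype.mk.inj h'))

/-- The subcategory is full: the outer factors leave only morphisms with both ends in `𝒦`. -/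
theorem incl_mul_mul_incl_mem_range (h : 𝒦 ⊆ 𝒦') (a b : Lam ℓ 𝒦) (x : Lam ℓ 𝒦') :
    incl ℓ h a * x * incl ℓ h b ∈ LinearMap.range (incl ℓ h) := by
  have left : ∀ U : Mor 𝒦', U.cod.1 ∈ 𝒦 → sq ℓ U * incl ℓ h b ∈ LinearMap.range (incl ℓ h) := by
    rintro ⟨⟨F, hF'⟩, G, U⟩ hF
    induction b using lam_induction with
    | zero => rw [map_zero, mul_zero]; exact zero_mem _
    | add b b' hb hb' => rw [map_add, mul_add]; exact add_mem hb hb'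
    | smul c V =>
      rw [map_smul, mul_smul_comm, incl_sq]
      refine Submodule.smul_mem _ _ ?_
      obtain ⟨G', H, V⟩ := V
      by_cases hG : ⟨G'.1, h G'.2⟩ = G
      · subst hG
        rw [sq_mul_sq]
        refine Submodule.smul_mem _ _ ⟨sq ℓ ⟨⟨F, hF⟩, H, star U V⟩, ?_⟩
        exact incl_sq ℓ h _
      · rw [sq_mul_sq_of_ne ℓ (U := ⟨⟨F, hF'⟩, G, U⟩) (V := ⟨⟨G'.1, h G'.2⟩, ⟨H.1, h H.2⟩, V⟩) hG]
        exact zero_mem _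
  induction a using lam_induction with
  | zero => rw [map_zero, zero_mul, zero_mul]; exact zero_mem _
  | add a a' ha ha' => rw [map_add, add_mul, add_mul]; exact add_mem ha ha'
  | smul c U =>
    induction x using lam_induction with
    | zero => rw [mul_zero, zero_mul]; exact zero_mem _
    | add x y hx hy => rw [mul_add, add_mul]; exact add_mem hx hy
    | smul d V =>
      rw [map_smul, smul_mul_assoc, mul_smul_comm, smul_mul_assoc, smul_mul_assoc, incl_sq]
      refine Submodule.smul_mem _ _ (Submodule.smul_mem _ _ ?_)
      obtain ⟨F, G, U⟩ := U
      obtain ⟨G', H, V⟩ := V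
      by_cases hG : G' = ⟨G.1, h G.2⟩
      · subst hG
        rw [sq_mul_sq, smul_mul_assoc]
        exact Submodule.smul_mem _ _ (left _ F.2)
      · rw [sq_mul_sq_of_ne ℓ (U := ⟨⟨F.1, h F.2⟩, ⟨G.1, h G.2⟩, U⟩) (V := ⟨G', H, V⟩) hG, zero_mul]
        exact zero_mem _

/-- This makes the simple quotient for `𝒦` embed in the one for `𝒦'`. The scalar in `e b a e = c e`
can be read off in the larger algebra. Conversely, if `f a = a`, then an arbitrary `b` of the larger
algebra enters only through `e b f`, which comes from the smaller one. -/
theorem incl_mem_dualAnnihilator_iff (h : 𝒦 ⊆ 𝒦') (F : 𝒦) (a : Lam ℓ 𝒦) :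
    incl ℓ h a ∈ dualAnnihilator (incl ℓ h (botElem ℓ F)) ↔
      a ∈ dualAnnihilator (botElem ℓ F) := by
  have he := isRankOneIdempotent_botElem ℓ F
  constructor
  · intro ha b
    obtain ⟨c, hc⟩ := he.corner (b * a)
    have hc' : botElem ℓ F * b * (a * botElem ℓ F) = c • botElem ℓ F := by
      rw [← hc]; simp only [mul_assoc]
    have h0 : c • incl ℓ h (botElem ℓ F) = 0 := by
      rw [← map_smul, ← hc', incl_mul, incl_mul, incl_mul]
      exact ha (incl ℓ h b)
    have hne : incl ℓ h (botElem ℓ F) ≠ 0 := by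
      rw [incl_botElem]
      exact sq_ne_zero ℓ _
    rw [hc', (smul_eq_zero.1 h0).resolve_right hne, zero_smul]
  · intro ha b
    obtain ⟨f, -, hf⟩ := he.exists_unit a
    obtain ⟨y, hy⟩ := incl_mul_mul_incl_mem_range ℓ h (botElem ℓ F) f b
    have key : incl ℓ h (botElem ℓ F) * b * (incl ℓ h a * incl ℓ h (botElem ℓ F)) =
        incl ℓ h (botElem ℓ F * y * (a * botElem ℓ F)) := by
      rw [incl_mul, incl_mul, incl_mul, hy]
      nth_rewrite 1 [← hf, ← he.mul_self]
      rw [incl_mul, incl_mul]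
      simp only [mul_assoc]
    rw [key, ha y, map_zero]

/-! ### The trivial module -/

theorem rect_bot_bot_eq_idElem {E : 𝒦} [Subsingleton E.1] :
    rect ℓ (⊥ : Subgroup E.1) (⊥ : Subgroup E.1) = idElem ℓ E := by
  rw [rect, idElem]
  congr 2
  ext ⟨x, y⟩
  rw [mem_diag, Subgroup.mem_prod]
  exact ⟨fun _ => Subsingleton.elim _ _,
    fun _ => ⟨Subsingleton.elim (α := E.1) x 1, Subsingleton.elim (α := E.1) y 1⟩⟩

/-- At a trivial group `E` the identity is `s_{1 × 1}`, which factors as `E ← F ← E`. Hence a vector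
not killed by it is carried to a non-zero vector of `S'` at `F` fixed by `e`, which lies in `Λ S'`
and so comes from `S`. -/
theorem IsTrivialModule.exists_botElem_smul_eq {S : Type w} [AddCommGroup S]
    [LUModule (Lam ℓ 𝒦) S] (hS : IsTrivialModule ℓ 𝒦 S) (F : 𝒦) :
    ∃ x : S, x ≠ 0 ∧ botElem ℓ F • x = x := by
  obtain ⟨-, -, 𝒦', h, S', _, _, E, -, -, ⟨i⟩, ⟨y, hy⟩, -, f, -, hf, hrange⟩ := hS
  have : Subsingleton E.1 := i.toEquiv.subsingleton
  let F' : 𝒦' := ⟨F.1, h F.2⟩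
  let z : S' := rect ℓ (⊥ : Subgroup F'.1) (⊥ : Subgroup E.1) • y
  have hz : incl ℓ h (botElem ℓ F) • z = z := by
    rw [incl_botElem, ← mul_smul', botElem, rect_bot_mul_rect]
  have hz0 : z ≠ 0 := by
    intro h0
    apply hy
    rw [← rect_bot_bot_eq_idElem, ← rect_bot_mul_rect ℓ _ (⊥ : Subgroup F'.1), mul_smul']
    exact (congrArg _ h0).trans (smul_zero' _)
  have hzr : z ∈ f.range := by
    rw [hrange]
    exact AddSubgroup.subset_closure ⟨botElem ℓ F, z, hz.symm⟩
  obtain ⟨x, hx⟩ := hzr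
  have hfx : f (botElem ℓ F • x) = z := by rw [hf, hx, hz]
  refine ⟨botElem ℓ F • x, fun h0 => hz0 (by rw [← hfx, h0, map_zero]), ?_⟩
  rw [← mul_smul', (isRankOneIdempotent_botElem ℓ F).mul_self]

theorem isFactorGroup_of_subsingleton (S R : Type*) [Group S] [Group R] [Subsingleton S] :
    IsFactorGroup S R := by
  refine ⟨⊥, ⊥, inferInstance, ⟨?_⟩⟩
  have := (QuotientGroup.mk_surjective (s := (⊥ : Subgroup (⊥ : Subgroup R)))).subsingleton
  exact { toFun := fun _ => 1, invFun := fun _ => 1, left_inv := fun _ => Subsingleton.elim _ _,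
          right_inv := fun _ => Subsingleton.elim _ _, map_mul' := fun _ _ => (mul_one 1).symm }

theorem IsFactorGroup.subsingleton {S R : Type*} [Group S] [Group R] [Subsingleton R]
    (h : IsFactorGroup S R) : Subsingleton S := by
  obtain ⟨B, Y, _, ⟨i⟩⟩ := h
  have := (QuotientGroup.mk_surjective (s := Y)).subsingleton
  exact i.toEquiv.subsingleton

/-- The enlarged set consists of all finite groups in the universe, and `S'` is the same quotient
formed for that set. -/
theorem isTrivialModule_quotient (F : 𝒦) :
    @IsTrivialModule _ _ ℓ 𝒦 (Lam ℓ 𝒦 ⧸ dualAnnihilator (botElem ℓ F)) _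
      (isRankOneIdempotent_botElem ℓ F).quotientModule := by
  have he := isRankOneIdempotent_botElem ℓ F
  let := he.quotientModule
  have h : 𝒦 ⊆ Set.univ := Set.subset_univ 𝒦
  have he' : IsRankOneIdempotent 𝕂 (incl ℓ h (botElem ℓ F)) := by
    rw [incl_botElem]
    exact isRankOneIdempotent_botElem ℓ _
  let := he'.quotientModule
  refine ⟨he.isSimple_quotient, ⟨F.1, F.2, isFactorGroup_of_subsingleton _ _⟩, Set.univ, h,
    Lam ℓ Set.univ ⧸ dualAnnihilator (incl ℓ h (botElem ℓ F)), inferInstance, inferInstance,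
    ⟨FiniteGrp.of PUnit.{v + 1}, Set.mem_univ _⟩, fun G _ B Y _ =>
      ⟨FiniteGrp.of (B ⧸ Y), Set.mem_univ _, ⟨MulEquiv.refl _⟩⟩, he'.isSimple_quotient,
    ?_, ?_, ?_, ?_⟩
  · exact ⟨{ toFun := fun _ => 1, invFun := fun _ => 1, left_inv := fun _ => rfl,
             right_inv := fun _ => rfl, map_mul' := fun _ _ => rfl }⟩
  · set E : (Set.univ : Set FiniteGrp.{v}) := ⟨FiniteGrp.of PUnit.{v + 1}, Set.mem_univ _⟩
    have : Subsingleton E.1 := inferInstanceAs (Subsingleton PUnit)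
    let F' : (Set.univ : Set FiniteGrp.{v}) := ⟨F.1, Set.mem_univ _⟩
    -- The class of `s_{1 × 1}` from `F` to `E` is non-zero, because its pairing with `s_{1 × 1}`
    -- from `E` to `F` is `e`.
    refine ⟨(rect ℓ (⊥ : Subgroup E.1) (⊥ : Subgroup F'.1) : Lam ℓ Set.univ), fun h0 => ?_⟩
    have h1 : ((idElem ℓ E * rect ℓ (⊥ : Subgroup E.1) (⊥ : Subgroup F'.1) : Lam ℓ Set.univ) :
        Lam ℓ Set.univ ⧸ dualAnnihilator (incl ℓ h (botElem ℓ F))) = 0 := h0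
    rw [rect, idElem_mul_sq, ← rect, IsRankOneIdempotent.mk_eq_zero_iff, incl_botElem] at h1
    have h2 := h1 (rect ℓ (⊥ : Subgroup F'.1) (⊥ : Subgroup E.1))
    rw [botElem, rect_bot_mul_rect, rect_bot_mul_rect, rect_bot_mul_rect] at h2
    exact sq_ne_zero ℓ _ h2
  · intro G _ hG
    have : Subsingleton (FiniteGrp.of PUnit.{v + 1}) := inferInstanceAs (Subsingleton PUnit)
    have := hG.subsingleton
    exact ⟨{ toFun := fun _ => 1, invFun := fun _ => 1, left_inv := fun _ => Subsingleton.elim _ _,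
             right_inv := fun _ => Subsingleton.elim _ _, map_mul' := fun _ _ => rfl }⟩
  · let f : Lam ℓ 𝒦 ⧸ dualAnnihilator (botElem ℓ F) →+
        Lam ℓ Set.univ ⧸ dualAnnihilator (incl ℓ h (botElem ℓ F)) :=
      QuotientAddGroup.map (dualAnnihilator (botElem ℓ F))
        (dualAnnihilator (incl ℓ h (botElem ℓ F))) (incl ℓ h).toAddMonoidHom
        fun a ha => (incl_mem_dualAnnihilator_iff ℓ h F a).2 ha
    have hf : ∀ (a : Lam ℓ 𝒦) x, f (a • x) = incl ℓ h a • f x := by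
      intro a x
      obtain ⟨x, rfl⟩ := QuotientAddGroup.mk_surjective x
      exact congrArg QuotientAddGroup.mk (incl_mul ℓ h a x)
    refine ⟨f, (injective_iff_map_eq_zero f).2 fun x hx => ?_, hf, le_antisymm ?_ ?_⟩
    · obtain ⟨x, rfl⟩ := QuotientAddGroup.mk_surjective x
      refine (QuotientAddGroup.eq_zero_iff x).2 ((incl_mem_dualAnnihilator_iff ℓ h F x).1 ?_)
      exact (QuotientAddGroup.eq_zero_iff _).1 hx
    · rintro _ ⟨x, rfl⟩
      obtain ⟨e, -, hx⟩ := exists_idempotent (A := Lam ℓ 𝒦) x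
      refine AddSubgroup.subset_closure ⟨e, f x, ?_⟩
      rw [← hf, hx]
    · rw [AddSubgroup.closure_le]
      rintro _ ⟨a, y, rfl⟩
      obtain ⟨y, rfl⟩ := QuotientAddGroup.mk_surjective y
      -- In the quotient, `y` may be multiplied by `e` on the right, and then `a * y * e` has both
      -- ends in `𝒦`.
      obtain ⟨b, hb⟩ := incl_mul_mul_incl_mem_range ℓ h a (botElem ℓ F) y
      refine ⟨(b : Lam ℓ 𝒦), ?_⟩
      change ((incl ℓ h b : Lam ℓ Set.univ) : Lam ℓ Set.univ ⧸ dualAnnihilator _) =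
        ((incl ℓ h a * y : Lam ℓ Set.univ) : Lam ℓ Set.univ ⧸ dualAnnihilator _)
      rw [hb, he'.mk_mul_self]

end SubgroupCategory

/-! ### Application to the idempotent of the trivial subgroup of `F × F` -/

theorem theorem8p6 {𝕂 : Type u} [Field 𝕂] [CharZero 𝕂]
    (ℓ : ℕ+ →* 𝕂ˣ) (𝒦 : Set FiniteGrp.{v}) (h𝒦 : 𝒦.Nonempty)
    (hφ : ∀ G ∈ 𝒦, ∀ B : Subgroup G, SubgroupCategory.totient ℓ B ≠ 0) :
    (∃ (S : Type (max u (v + 1))) (_ : AddCommGroup S)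
      (_ : LUModule (SubgroupCategory.Lam ℓ 𝒦) S), SubgroupCategory.IsTrivialModule ℓ 𝒦 S) ∧
    ∀ (S : Type w) [AddCommGroup S] [LUModule (SubgroupCategory.Lam ℓ 𝒦) S],
      SubgroupCategory.IsTrivialModule ℓ 𝒦 S →
        LUModule.IsProjective.{w, w₁, w₂} (SubgroupCategory.Lam ℓ 𝒦) S ∧
        LUModule.IsInjective.{w, w₃, w₄} (SubgroupCategory.Lam ℓ 𝒦) S ∧
        (𝒦.Finite →
          (∃! b : SubgroupCategory.Lam ℓ 𝒦, SubgroupCategory.IsBlockFixing ℓ 𝒦 S b) ∧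
          ∀ b : SubgroupCategory.Lam ℓ 𝒦, SubgroupCategory.IsBlockFixing ℓ 𝒦 S b →
            IsSimpleRing (mulRightSubalgebra 𝕂 b)) := by
  obtain ⟨F, hF⟩ := h𝒦
  have he := SubgroupCategory.isRankOneIdempotent_botElem ℓ (⟨F, hF⟩ : 𝒦)
  have hd := SubgroupCategory.hasDualBases_botElem ℓ hφ ⟨F, hF⟩
  refine ⟨⟨_, _, _, SubgroupCategory.isTrivialModule_quotient ℓ ⟨F, hF⟩⟩, fun S _ _ hS => ?_⟩
  obtain ⟨x, hx, hex⟩ := hS.exists_botElem_smul_eq ℓ ⟨F, hF⟩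
  refine ⟨he.isProjective hd hS.1 hx hex, he.isInjective hd hS.1 hx hex, fun hfin => ?_⟩
  obtain ⟨i, hi⟩ := SubgroupCategory.exists_unit_of_finite ℓ hfin
  obtain ⟨j, hj, hc, hone⟩ := hd.exists_central hi
  have hjS : SubgroupCategory.IsBlockFixing ℓ 𝒦 S j := by
    refine ⟨he.isBlock hj hc hone, fun y => ?_⟩
    -- Every element of `S` is `a • x = (a * e) • x`, and `j` fixes `a * e`, an element of the
    -- ideal.
    obtain ⟨a, rfl⟩ := hS.1.exists_smul_eq hx y
    rw [← hex, ← LUModule.mul_smul' a, ← LUModule.mul_smul' j,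
      hone _ (mul_mem_sandwichIdeal a he.mem_sandwichIdeal)]
  have : Nontrivial S := hS.1.1
  have huniq : ∀ b, SubgroupCategory.IsBlockFixing ℓ 𝒦 S b → b = j := fun b hb =>
    IsRankOneIdempotent.eq_of_isBlock hb.1 hjS.1 hb.2 hjS.2
  refine ⟨⟨j, hjS, huniq⟩, fun b hb => ?_⟩
  rw [huniq b hb]
  exact he.isSimpleRing hd hj hc hone
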